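/- Let $d\ge 0$ be an integer, let $\mathcal P$ be a countable index set, and for each $p\in\mathcal P$ let $C_p$ be an invertible real $d\times d$ matrix, $C_p^*$ its transpose and $C_p'=(C_p^*)^{-1}$. Let $\hat f$ denote the Fourier transform on $L^2(\mathbb R^d)$ with $\hat f(\xi)=\int f(x)e^{-2\pi i x\cdot\xi}\,dx$ for $f\in L^1\cap L^2$, and for $\beta\in\mathbb R^d$ let $T_\beta f(x)=f(x-\beta)$. Put $$\Lambda=\bigcup_{p\in\mathcal P}C_p'\mathbb Z^d,\qquad \mathcal P_\alpha=\{p\in\mathcal P: C_p^*\alpha\in\mathbb Z^d\}\quad(\alpha\in\Lambda).$$ Let $\{g_p\}_{p\in\mathcal P},\{h_p\}_{p\in\mathcal P}\subset L^2(\mathbb R^d)$ be such that each of the systems $\{T_{C_pk}g_p\}_{p\in\mathcal P,k\in\mathbb Z^d}$ and $\{T_{C_pk}h_p\}_{p\in\mathcal P,k\in\mathbb Z^d}$ satisfies: * the Bessel condition: there is $M<\infty$ with $\sum_{p\in\mathcal P}\sum_{k\in\mathbb Z^d}|\langle f,T_{C_pk}g_p\rangle|^2\le M\|f\|^2$ for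 all $f\in L^2(\mathbb R^d)$ (respectively with $h_p$ in place of $g_p$); * the local integrability condition: for every $f\in L^2(\mathbb R^d)$ such that $\hat f\in L^\infty(\mathbb R^d)$ and $\operatorname{supp}\hat f$ is compact and bounded away from $0$, $$\sum_{p\in\mathcal P}\sum_{k\in\mathbb Z^d}\int_{\operatorname{supp}\hat f}|\hat f(\xi+C_p'k)|^2\,|\det C_p|^{-1}|\hat g_p(\xi)|^2\,d\xi<\infty$$ (respectively with $\hat h_p$ in place of $\hat g_p$). Let $\Theta$ be the bounded operator on $L^2(\mathbb R^d)$ given by $$\Theta f=\sum_{p\in\mathcal P}\sum_{k\in\mathbb Z^d}\langle f,T_{C_pk}h_p\rangle\,T_{C_pk}g_p .$$ Then the series $$s(\xi)=\sum_{p\in\mathcal P}|\det C_p|^{-1}\overline{\hat h_p(\xi)}\,\hat g_p(\xi)\qquad\text{and}\qquad \sum_{p\in\mathcal P_\alpha}|\det C_p|^{-1}\overline{\hat h_p(\xi)}\,\hat g_p(\xi+\alpha)\quad(\alpha\in\Lambda)$$ converge absolutely for a.e. $\xi$, and the following hold. 1. $\Theta=0$ if and only if $\Theta$ commutes with $T_\beta$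 for every $\beta\in\mathbb R^d$ and $s(\xi)=0$ for a.e. $\xi$. 2. $\Theta=0$ if and only if $s(\xi)=0$ for a.e. $\xi$ and, for every $\alpha\in\Lambda\setminus\{0\}$, $$\sum_{p\in\mathcal P_\alpha}|\det C_p|^{-1}\overline{\hat h_p(\xi)}\,\hat g_p(\xi+\alpha)=0\quad\text{for a.e. }\xi .$$ -/

import Mathlib

open MeasureTheory Topology Matrix
open scoped FourierTransform ENNReal

/-! ### Bessel families, analysis operators and mixed dual Gramians in a Hilbert space -/

section Bessel

variable {ι H : Type*} [NormedAddCommGroup H] [InnerProductSpace ℂ H]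

/-- A family `x` in a Hilbert space satisfies the Bessel condition if
`∑ j, |⟨v, x j⟩|² ≤ M ‖v‖²` for all `v` and some finite constant `M`. -/
def IsBessel (x : ι → H) : Prop :=
  ∃ M : ℝ, ∀ v : H, Summable (fun j => ‖inner ℂ (x j) v‖ ^ 2) ∧
    ∑' j, ‖inner ℂ (x j) v‖ ^ 2 ≤ M * ‖v‖ ^ 2

/-- The coefficient sequence `(⟨v, x j⟩)_j` of a Bessel family, as an element of `ℓ²`. Mathlib's
inner product is linear in the second variable, so `⟨v, x j⟩` is `inner ℂ (x j) v`. -/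
noncomputable def IsBessel.coeff {x : ι → H} (hx : IsBessel x) (v : H) : lp (fun _ : ι => ℂ) 2 :=
  ⟨fun j => inner ℂ (x j) v, memℓp_gen (by
    obtain ⟨M, hM⟩ := hx
    simpa using (hM v).1)⟩

/-- The analysis operator `θ_x : v ↦ (⟨v, x j⟩)_j`, from `H` to `ℓ²`, of a Bessel family `x`. -/
noncomputable def IsBessel.analysis {x : ι → H} (hx : IsBessel x) :
    H →L[ℂ] lp (fun _ : ι => ℂ) 2 :=
  LinearMap.mkContinuousOfExistsBound
    { toFun := hx.coeff
      map_add' := fun v w => by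
        ext j
        exact inner_add_right (x j) v w
      map_smul' := fun c v => by
        ext j
        exact inner_smul_right (x j) v c }
    (by
      obtain ⟨M, hM⟩ := id hx
      refine ⟨Real.sqrt |M|, fun v => ?_⟩
      have h1 : ‖hx.coeff v‖ ^ 2 = ∑' j, ‖inner ℂ (x j) v‖ ^ 2 := by
        have h := lp.norm_rpow_eq_tsum (p := 2) (by norm_num) (hx.coeff v)
        simpa [IsBessel.coeff] using h
      have h2 : ‖hx.coeff v‖ ^ 2 ≤ (Real.sqrt |M| * ‖v‖) ^ 2 := by
        rw [h1, mul_pow, Real.sq_sqrt (abs_nonneg M)]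
        exact (hM v).2.trans (mul_le_mul_of_nonneg_right (le_abs_self M) (sq_nonneg _))
      exact abs_le_of_sq_le_sq' h2 (by positivity) |>.2)

@[simp]
theorem IsBessel.analysis_apply {x : ι → H} (hx : IsBessel x) (v : H) (j : ι) :
    hx.analysis v j = inner ℂ (x j) v := rfl

variable [CompleteSpace H]

/-- The mixed dual Gramian `θ_y^* θ_x` of two Bessel families `x` and `y`. -/
noncomputable def mixedGramian {x y : ι → H} (hx : IsBessel x) (hy : IsBessel y) : H →L[ℂ] H :=
  (ContinuousLinearMap.adjoint hy.analysis).comp hx.analysis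

/-- The mixed dual Gramian is the convergent sum `v ↦ ∑ j, ⟨v, x j⟩ y j`. -/
theorem hasSum_mixedGramian {x y : ι → H} (hx : IsBessel x) (hy : IsBessel y) (v : H) :
    HasSum (fun j => (inner ℂ (x j) v : ℂ) • y j) (mixedGramian hx hy v) := by
  classical
  have h := (lp.hasSum_single (E := fun _ : ι => ℂ) (p := 2) (by norm_num) (hx.analysis v)).map
    (ContinuousLinearMap.adjoint hy.analysis)
    (ContinuousLinearMap.adjoint hy.analysis).continuous
  change HasSum _ (ContinuousLinearMap.adjoint hy.analysis (hx.analysis v))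
  convert h using 1
  funext j
  refine ext_inner_right ℂ fun w => ?_
  simp only [Function.comp]
  rw [ContinuousLinearMap.adjoint_inner_left, lp.inner_single_left, inner_smul_left,
    IsBessel.analysis_apply, IsBessel.analysis_apply]
  simp [mul_comm]

end Bessel

/-! ### Translation systems in `L²(ℝᵈ)` -/

/-- `ℝᵈ` with its Euclidean structure. -/
abbrev Rd (d : ℕ) : Type := EuclideanSpace ℝ (Fin d)

/-- `L²(ℝᵈ)` with complex values and Lebesgue measure. -/
noncomputable abbrev L2Rd (d : ℕ) : Type := Lp (α := Rd d) ℂ 2 (volume : Measure (Rd d))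

/-- A representative of the Fourier transform `f̂` of `f ∈ L²(ℝᵈ)`, the continuous extension to
`L²(ℝᵈ)` of `f̂(ξ) = ∫ f(x) exp(-2πi x·ξ) dx`. -/
noncomputable def fhat {d : ℕ} (f : L2Rd d) : Rd d → ℂ :=
  ((𝓕 f : L2Rd d) : Rd d → ℂ)

/-- The translation operator `T_β : f ↦ f(· - β)` on `L²(ℝᵈ)`. -/
noncomputable def translation {d : ℕ} (β : Rd d) : L2Rd d →L[ℂ] L2Rd d :=
  (Lp.compMeasurePreservingₗᵢ ℂ (fun x : Rd d => x - β)
    (measurePreserving_sub_right volume β)).toContinuousLinearMap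

/-- The vector `C k ∈ ℝᵈ` for a real `d × d` matrix `C` and `k ∈ ℤᵈ`. -/
noncomputable def latticePoint {d : ℕ} (C : Matrix (Fin d) (Fin d) ℝ) (k : Fin d → ℤ) : Rd d :=
  WithLp.toLp 2 (C *ᵥ fun i => (k i : ℝ))

/-- `C' = (C^*)⁻¹`, the inverse of the transpose. -/
noncomputable def contragredient {d : ℕ} (C : Matrix (Fin d) (Fin d) ℝ) :
    Matrix (Fin d) (Fin d) ℝ :=
  (Cᵀ)⁻¹

/-- The system `{T_{C_p k} g_p}`, indexed by `(p, k) ∈ P × ℤᵈ`. -/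
noncomputable def translationSystem {d : ℕ} {P : Type*} (C : P → Matrix (Fin d) (Fin d) ℝ)
    (g : P → L2Rd d) : P × (Fin d → ℤ) → L2Rd d :=
  fun q => translation (latticePoint (C q.1) q.2) (g q.1)

/-- The (closed) essential support of a function on `ℝᵈ`. -/
def essSupport {d : ℕ} (F : Rd d → ℂ) : Set (Rd d) :=
  {ξ | ∀ U ∈ 𝓝 ξ, 0 < volume {η | η ∈ U ∧ F η ≠ 0}}

/-- The space `𝒟` of those `f ∈ L²(ℝᵈ)` for which `f̂` is essentially bounded and has compact
support that is bounded away from `0`. -/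
def testSpace (d : ℕ) : Set (L2Rd d) :=
  {f | MemLp (fhat f) ∞ volume ∧ IsCompact (essSupport (fhat f)) ∧
    ∃ r : ℝ, 0 < r ∧ ∀ ξ ∈ essSupport (fhat f), r ≤ ‖ξ‖}

/-- The local integrability condition for `{T_{C_p k} g_p}`: for all `f ∈ 𝒟`,
`∑_p ∑_k ∫_{supp f̂} |f̂(ξ + C_p' k)|² |det C_p|⁻¹ |ĝ_p(ξ)|² dξ < ∞`. -/
def LocallyIntegrableSystem {d : ℕ} {P : Type*} (C : P → Matrix (Fin d) (Fin d) ℝ)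
    (g : P → L2Rd d) : Prop :=
  ∀ f ∈ testSpace d,
    ∑' (p : P) (k : Fin d → ℤ), ∫⁻ ξ in essSupport (fhat f),
      ‖fhat f (ξ + latticePoint (contragredient (C p)) k)‖ₑ ^ 2 *
        ENNReal.ofReal (|(C p).det|⁻¹) * ‖fhat (g p) ξ‖ₑ ^ 2 < ∞

/-- `Λ = ⋃_p C_p' ℤᵈ`. -/
def dualLattices {d : ℕ} {P : Type*} (C : P → Matrix (Fin d) (Fin d) ℝ) : Set (Rd d) :=
  ⋃ p, Set.range (latticePoint (contragredient (C p)))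

/-- `P_α = {p : C_p^* α ∈ ℤᵈ}`. -/
def indexSet {d : ℕ} {P : Type*} (C : P → Matrix (Fin d) (Fin d) ℝ) (α : Rd d) : Set P :=
  {p | ∃ z : Fin d → ℤ, (C p)ᵀ *ᵥ (fun i => α i) = fun i => (z i : ℝ)}

/-- The term `|det C_p|⁻¹ conj(ĥ_p(ξ)) ĝ_p(ξ + α)`. -/
noncomputable def symbolTerm {d : ℕ} {P : Type*} (C : P → Matrix (Fin d) (Fin d) ℝ)
    (g h : P → L2Rd d) (α : Rd d) (p : P) (ξ : Rd d) : ℂ :=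
  ((|(C p).det|⁻¹ : ℝ) : ℂ) * (starRingEnd ℂ) (fhat (h p) ξ) * fhat (g p) (ξ + α)

/-- The symbol `s(ξ) = ∑_p |det C_p|⁻¹ conj(ĥ_p(ξ)) ĝ_p(ξ)`. -/
noncomputable def symbol {d : ℕ} {P : Type*} (C : P → Matrix (Fin d) (Fin d) ℝ)
    (g h : P → L2Rd d) (ξ : Rd d) : ℂ :=
  ∑' p : P, ((|(C p).det|⁻¹ : ℝ) : ℂ) * (starRingEnd ℂ) (fhat (h p) ξ) * fhat (g p) ξ

/-- `Θ = θ_g^* θ_h = ∑_p ∑_k ⟨·, T_{C_p k} h_p⟩ T_{C_p k} g_p`. -/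
noncomputable def Theta {d : ℕ} {P : Type*} {C : P → Matrix (Fin d) (Fin d) ℝ}
    {g h : P → L2Rd d} (hg : IsBessel (translationSystem C g))
    (hh : IsBessel (translationSystem C h)) : L2Rd d →L[ℂ] L2Rd d :=
  mixedGramian hh hg

/-- The commutant `{T_β : β ∈ ℝᵈ}'`. -/
def translationCommutant (d : ℕ) : Set (L2Rd d →L[ℂ] L2Rd d) :=
  Set.centralizer (Set.range (translation (d := d)))

/-! ### The Fourier transform on `L²(ℝᵈ)` -/

/-! Take measurable sets `E`, `E'` inside a shell and bandlimited functions `v`, `u` whose Fourier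
transforms are the indicators of `E`, `E'`. Everything is read off from the correlation `x ↦ ⟨Θ T_x
v, T_x u⟩`. For fixed `p`, the coefficients `⟨T_x v, T_{C_p k} h_p⟩` are samples on `C_p ℤᵈ` of the
Fourier transform of a function of bounded support, so Parseval's identity on a torus
(`hasSum_lattice_samples`, `hasSum_layer`) turns the sum over `k` into a series of characters
`exp(2πi x·α)` with `α ∈ C_p' ℤᵈ`. Local integrability makes the sum over all `p` absolutely
convergent (`tsum_lintegral_symbolTerm_ne_top`), so the correlation is an almost periodic function
(`inner_Theta_translation_bandlimited`). Its total coefficient at `α` is the integral over `E ∩ (E'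
- α)` of the series over `P_α` (`tsum_fiber_coefficient`).

Such a function determines its coefficients (`tsum_trivial_character_eq`). If `Θ = 0`, all of them
vanish, for all `E`, `E'`, and hence so do all the symbol series. If `Θ` commutes with translations,
the correlation is constant in `x` and equals its coefficient at `α = 0`, an integral of `s`; if `s
= 0` it vanishes. If all the series vanish, the correlation is zero already at `x = 0`. In the last
two cases `Θ = 0`, because bandlimited functions of this kind separate operators
(`continuousLinearMap_eq_zero_of_bandlimited`). -/

theorem aestronglyMeasurable_fhat {d : ℕ} (f : L2Rd d) :
    AEStronglyMeasurable (fhat f) volume :=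
  (Lp.memLp (𝓕 f : L2Rd d)).aestronglyMeasurable

theorem memLp_fhat {d : ℕ} (f : L2Rd d) : MemLp (fhat f) 2 volume :=
  Lp.memLp (𝓕 f : L2Rd d)

theorem inner_eq_integral_fhat {d : ℕ} (f g : L2Rd d) :
    inner ℂ f g = ∫ ξ, (starRingEnd ℂ) (fhat f ξ) * fhat g ξ := by
  rw [← Lp.inner_fourier_eq f g, L2.inner_def]
  exact integral_congr_ae (.of_forall fun ξ => RCLike.inner_apply' _ _)

theorem eq_zero_of_fhat_ae_eq_zero {d : ℕ} {f : L2Rd d} (hf : fhat f =ᵐ[volume] 0) : f = 0 := by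
  have h : inner ℂ f f = (0 : ℂ) := by
    rw [inner_eq_integral_fhat]
    refine integral_eq_zero_of_ae ?_
    filter_upwards [hf] with ξ hξ
    simp [hξ]
  exact inner_self_eq_zero.1 h

/-- The character `ξ ↦ exp (2πi x·ξ)` of `ℝᵈ`. -/
noncomputable def character {d : ℕ} (x ξ : Rd d) : ℂ := (𝐞 (inner ℝ x ξ) : ℂ)

@[simp]
theorem norm_character {d : ℕ} (x ξ : Rd d) : ‖character x ξ‖ = 1 := Circle.norm_coe _

theorem character_add_right {d : ℕ} (x ξ η : Rd d) :
    character x (ξ + η) = character x ξ * character x η := by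
  simp [character, inner_add_right, AddChar.map_add_eq_mul]

theorem conj_character {d : ℕ} (x ξ : Rd d) :
    (starRingEnd ℂ) (character x ξ) = character x (-ξ) := by
  simp [character, inner_neg_right, AddChar.map_neg_eq_inv]

theorem character_neg_left {d : ℕ} (x ξ : Rd d) : character (-x) ξ = character x (-ξ) := by
  simp [character]

@[simp]
theorem character_zero_left {d : ℕ} (ξ : Rd d) : character 0 ξ = 1 := by simp [character]

@[simp]
theorem character_zero_right {d : ℕ} (x : Rd d) : character x 0 = 1 := by simp [character]

theorem continuous_character {d : ℕ} (x : Rd d) : Continuous (character x) := by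
  unfold character
  exact continuous_subtype_val.comp (Real.continuous_fourierChar.comp (by fun_prop))

theorem memLp_character_mul {d : ℕ} (x : Rd d) {f : Rd d → ℂ} (hf : MemLp f 2 volume) :
    MemLp (fun ξ => character x ξ * f ξ) 2 volume :=
  hf.of_le ((continuous_character x).aestronglyMeasurable.mul hf.1)
    (Filter.Eventually.of_forall fun ξ => by simp)

/-- Multiplication by the character `exp (2πi x·ξ)` on `L²(ℝᵈ)`. -/
noncomputable def modulation {d : ℕ} (x : Rd d) : L2Rd d →ₗᵢ[ℂ] L2Rd d where
  toFun f := (memLp_character_mul x (Lp.memLp f)).toLp _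
  map_add' f g := by
    apply Lp.ext
    filter_upwards [MemLp.coeFn_toLp (memLp_character_mul x (Lp.memLp (f + g))),
      MemLp.coeFn_toLp (memLp_character_mul x (Lp.memLp f)),
      MemLp.coeFn_toLp (memLp_character_mul x (Lp.memLp g)), Lp.coeFn_add f g,
      Lp.coeFn_add ((memLp_character_mul x (Lp.memLp f)).toLp _)
        ((memLp_character_mul x (Lp.memLp g)).toLp _)] with ξ h1 h2 h3 h4 h5
    rw [h1, h5, Pi.add_apply, h2, h3, h4, Pi.add_apply, mul_add]
  map_smul' c f := by
    apply Lp.ext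
    filter_upwards [MemLp.coeFn_toLp (memLp_character_mul x (Lp.memLp (c • f))),
      MemLp.coeFn_toLp (memLp_character_mul x (Lp.memLp f)), Lp.coeFn_smul c f,
      Lp.coeFn_smul c ((memLp_character_mul x (Lp.memLp f)).toLp _)] with ξ h1 h2 h3 h4
    rw [h1, h3, RingHom.id_apply, h4, Pi.smul_apply, Pi.smul_apply, h2, smul_eq_mul, smul_eq_mul]
    ring
  norm_map' f := by
    rw [Lp.norm_def, Lp.norm_def]
    refine congrArg ENNReal.toReal (eLpNorm_congr_norm_ae ?_)
    filter_upwards [MemLp.coeFn_toLp (memLp_character_mul x (Lp.memLp f))] with ξ h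
    change ‖((memLp_character_mul x (Lp.memLp f)).toLp _ : L2Rd d) ξ‖ = _
    rw [h]; simp

theorem coeFn_modulation {d : ℕ} (x : Rd d) (f : L2Rd d) :
    modulation x f =ᵐ[volume] fun ξ => character x ξ * f ξ :=
  MemLp.coeFn_toLp (memLp_character_mul x (Lp.memLp f))

theorem coeFn_translation {d : ℕ} (β : Rd d) (f : L2Rd d) :
    translation β f =ᵐ[volume] fun x => f (x - β) :=
  Lp.coeFn_compMeasurePreserving f (measurePreserving_sub_right volume β)

theorem translation_toLp {d : ℕ} (β : Rd d) (f : SchwartzMap (Rd d) ℂ) :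
    translation β (f.toLp 2) = (SchwartzMap.compSubConstCLM ℂ β f).toLp 2 := by
  apply Lp.ext
  filter_upwards [coeFn_translation β (f.toLp 2),
    (measurePreserving_sub_right volume β).quasiMeasurePreserving.ae_eq_comp
      (SchwartzMap.coeFn_toLp f 2 volume),
    SchwartzMap.coeFn_toLp (SchwartzMap.compSubConstCLM ℂ β f) 2 volume] with x h1 h2 h3
  simp only [Function.comp] at h2
  rw [h1, h2, h3]
  rfl

/-- Both sides are continuous in `f`, so density reduces the identity to Schwartz functions, where
it is a change of variables in the Fourier integral. -/
theorem fourier_translation {d : ℕ} (β : Rd d) (f : L2Rd d) :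
    (𝓕 (translation β f) : L2Rd d) = modulation (-β) (𝓕 f : L2Rd d) := by
  have hdense : DenseRange (SchwartzMap.toLpCLM ℂ (E := Rd d) ℂ 2 volume) :=
    SchwartzMap.denseRange_toLpCLM ENNReal.ofNat_ne_top
  refine hdense.induction_on (p := fun f : L2Rd d =>
    (𝓕 (translation β f) : L2Rd d) = modulation (-β) (𝓕 f : L2Rd d)) f ?_ ?_
  · refine isClosed_eq ?_ ?_
    · exact (Lp.fourierTransformₗᵢ (Rd d) ℂ).continuous.comp (translation β).continuous
    · exact (modulation (-β)).continuous.comp (Lp.fourierTransformₗᵢ (Rd d) ℂ).continuous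
  · intro f
    change (𝓕 (translation β (f.toLp 2)) : L2Rd d) = modulation (-β) (𝓕 (f.toLp 2) : L2Rd d)
    rw [translation_toLp, SchwartzMap.toLp_fourier_eq, SchwartzMap.toLp_fourier_eq]
    apply Lp.ext
    filter_upwards [SchwartzMap.coeFn_toLp (𝓕 (SchwartzMap.compSubConstCLM ℂ β f)) 2 volume,
      SchwartzMap.coeFn_toLp (𝓕 f) 2 volume,
      coeFn_modulation (-β) ((𝓕 f).toLp 2)] with ξ h1 h2 h3
    rw [h1, h3, h2, SchwartzMap.fourier_coe, SchwartzMap.fourier_coe]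
    have h := congrFun (VectorFourier.fourierIntegral_comp_add_right 𝐞 (volume : Measure (Rd d))
      (innerₗ (Rd d)) (f : Rd d → ℂ) (-β)) ξ
    exact h

theorem fhat_translation {d : ℕ} (β : Rd d) (f : L2Rd d) :
    fhat (translation β f) =ᵐ[volume] fun ξ => character (-β) ξ * fhat f ξ := by
  unfold fhat
  rw [fourier_translation]
  exact coeFn_modulation (-β) _

/-- The element of `L²(ℝᵈ)` whose Fourier transform is the indicator function of `E`. -/
noncomputable def bandlimited {d : ℕ} {E : Set (Rd d)} (hE : MeasurableSet E)
    (hE' : volume E ≠ ∞) : L2Rd d :=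
  (𝓕⁻ (indicatorConstLp 2 hE hE' (1 : ℂ)) : L2Rd d)

theorem fhat_bandlimited {d : ℕ} {E : Set (Rd d)} (hE : MeasurableSet E)
    (hE' : volume E ≠ ∞) : fhat (bandlimited hE hE') =ᵐ[volume] E.indicator 1 := by
  unfold fhat bandlimited
  rw [FourierTransform.fourier_fourierInv_eq]
  exact indicatorConstLp_coeFn

/-! ### Parseval's identity for samples of the Fourier transform on a lattice -/

section Torus

attribute [local instance] instMeasureSpaceUnitAddCircle

variable {ι : Type*}

/-- The section of `ℝᶥ → (ℝ/ℤ)ᶥ` with values in the half-open unit box with corner `a`. -/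
noncomputable def torusSection (a : ι → ℝ) (t : UnitAddTorus ι) : ι → ℝ :=
  fun i => (AddCircle.equivIoc 1 (a i) (t i)).1

theorem coe_torusSection (a : ι → ℝ) (t : UnitAddTorus ι) (i : ι) :
    ((torusSection a t i : ℝ) : UnitAddCircle) = t i :=
  AddCircle.coe_equivIoc

theorem torusSection_intCast (n : ι → ℤ) (t : UnitAddTorus ι) :
    torusSection (fun i => (n i : ℝ)) t = torusSection 0 t + fun i => (n i : ℝ) := by
  funext i
  have h1 : ((torusSection 0 t i + n i : ℝ) : UnitAddCircle) = t i := by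
    rw [AddCircle.coe_add, coe_torusSection]
    simp
  have h2 : torusSection 0 t i + n i ∈ Set.Ioc (n i : ℝ) (n i + 1) := by
    have := (AddCircle.equivIoc (1 : ℝ) 0 (t i)).2
    simp only [torusSection, Pi.zero_apply]
    constructor <;> [linarith [this.1]; linarith [this.2]]
  have h3 := AddCircle.equivIoc_coe_of_mem (p := (1 : ℝ)) (a := (n i : ℝ)) h2
  rw [h1] at h3
  exact h3

variable [Fintype ι]

/-- The half-open unit box with corner `a`. -/
def unitBox (a : ι → ℝ) : Set (ι → ℝ) := {x | ∀ i, x i ∈ Set.Ioc (a i) (a i + 1)}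

theorem measurableSet_unitBox (a : ι → ℝ) : MeasurableSet (unitBox a) := by
  have : unitBox a = Set.pi Set.univ fun i => Set.Ioc (a i) (a i + 1) := by
    ext x; simp [unitBox]
  rw [this]
  exact MeasurableSet.univ_pi fun i => measurableSet_Ioc

theorem measurePreserving_torusSection (a : ι → ℝ) :
    MeasurePreserving (torusSection a) volume (volume.restrict (unitBox a)) :=
  (measurePreserving_subtype_coe (measurableSet_unitBox a)).comp
    (UnitAddTorus.measurePreserving_equivPiIoc a)

theorem measurableEmbedding_torusSection (a : ι → ℝ) : MeasurableEmbedding (torusSection a) :=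
  (MeasurableEmbedding.subtype_coe (measurableSet_unitBox a)).comp
    (UnitAddTorus.measurableEquivPiIoc a).measurableEmbedding

/-- The unit boxes with integer corners tile the space, and each of them is a measure-preserving
copy of the torus. -/
theorem hasSum_integral_torusSection {φ : (ι → ℝ) → ℂ} (hφ : Integrable φ volume) :
    HasSum (fun n : ι → ℤ => ∫ t : UnitAddTorus ι, φ (torusSection 0 t + fun i => (n i : ℝ)))
      (∫ x, φ x) := by
  have hU : (⋃ n : ι → ℤ, unitBox fun i => (n i : ℝ)) = Set.univ := by
    refine Set.eq_univ_of_forall fun x => Set.mem_iUnion.2 ⟨fun i => ⌈x i⌉ - 1, fun i => ?_⟩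
    have h1 := Int.ceil_lt_add_one (x i)
    have h2 := Int.le_ceil (x i)
    push_cast
    constructor <;> linarith
  have hD : Pairwise (Function.onFun Disjoint fun n : ι → ℤ => unitBox fun i => (n i : ℝ)) := by
    intro m n hmn
    refine Set.disjoint_left.2 fun x hm hn => hmn (funext fun i => ?_)
    have h1 := hm i
    have h2 := hn i
    have h3 : (m i : ℝ) < n i + 1 := h1.1.trans_le h2.2
    have h4 : (n i : ℝ) < m i + 1 := h2.1.trans_le h1.2
    norm_cast at h3 h4
    omega
  have h := hasSum_integral_iUnion (fun n : ι → ℤ => measurableSet_unitBox fun i => (n i : ℝ)) hD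
    (f := φ) (μ := volume) hφ.integrableOn
  rw [hU, setIntegral_univ] at h
  refine h.congr_fun fun n => ?_
  rw [← (measurePreserving_torusSection _).integral_comp (measurableEmbedding_torusSection _)]
  simp only [torusSection_intCast]

theorem memLp_comp_torusSection {φ : (ι → ℝ) → ℂ} (hφ : MemLp φ 2 volume) (n : ι → ℤ) :
    MemLp (fun t : UnitAddTorus ι => φ (torusSection 0 t + fun i => (n i : ℝ))) 2 volume := by
  simp only [← torusSection_intCast]
  exact (hφ.restrict (unitBox _)).comp_measurePreserving (measurePreserving_torusSection _)

theorem mFourier_eq_fourierChar (k : ι → ℤ) (t : UnitAddTorus ι) (n : ι → ℤ) :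
    (𝐞 (∑ i, (k i : ℝ) * (torusSection 0 t i + n i)) : ℂ) = UnitAddTorus.mFourier k t := by
  have h : ∀ i, (𝐞 ((k i : ℝ) * (torusSection 0 t i + n i)) : ℂ) = fourier (k i) (t i) := by
    intro i
    have h1 : ((torusSection 0 t i + n i : ℝ) : UnitAddCircle) = t i := by
      rw [AddCircle.coe_add, coe_torusSection]
      simp
    rw [← h1, fourier_coe_apply, Real.fourierChar_apply]
    congr 1
    push_cast
    ring
  simp only [UnitAddTorus.mFourier, ContinuousMap.coe_mk, ← h]
  exact (map_prod (Circle.coeHom.comp Real.fourierChar.toMonoidHom)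
    (fun i => Multiplicative.ofAdd ((k i : ℝ) * (torusSection 0 t i + n i))) Finset.univ)

/-- The set of integer vectors with entries in `[-N, N]`. -/
noncomputable def intBox (ι : Type*) [Fintype ι] [DecidableEq ι] (N : ℤ) : Finset (ι → ℤ) :=
  Fintype.piFinset fun _ => Finset.Icc (-N) N

/-- Bounded support makes periodization a finite sum. The section takes values in `(0, 1]`, so a
nonzero value forces `|n i| ≤ R + 1`. -/
theorem apply_torusSection_eq_zero [DecidableEq ι] {F : (ι → ℝ) → ℂ} {R : ℝ}
    (hF : ∀ x, F x ≠ 0 → ‖x‖ ≤ R) {n : ι → ℤ} (hn : n ∉ intBox ι (⌈R⌉ + 1))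
    (t : UnitAddTorus ι) : F (torusSection 0 t + fun i => (n i : ℝ)) = 0 := by
  by_contra h
  have h1 := hF _ h
  apply hn
  refine Fintype.mem_piFinset.2 fun i => Finset.mem_Icc.2 ?_
  have h2 := abs_le.1 ((norm_le_pi_norm _ i).trans h1)
  have h3 := (AddCircle.equivIoc (1 : ℝ) 0 (t i)).2
  have h4 := Int.le_ceil R
  change _ ≤ torusSection 0 t i + (n i : ℝ) ∧ torusSection 0 t i + (n i : ℝ) ≤ _ at h2
  change 0 < torusSection 0 t i ∧ torusSection 0 t i ≤ 0 + 1 at h3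
  constructor
  · have : (-(⌈R⌉ + 1 : ℤ) : ℝ) ≤ n i := by push_cast; linarith
    exact_mod_cast this
  · have : (n i : ℝ) ≤ (⌈R⌉ + 1 : ℤ) := by push_cast; linarith
    exact_mod_cast this

theorem mFourierCoeff_toLp_of_memLp {f : UnitAddTorus ι → ℂ} (hf : MemLp f 2 volume)
    (k : ι → ℤ) :
    UnitAddTorus.mFourierCoeff (hf.toLp f) k = UnitAddTorus.mFourierCoeff f k := by
  refine integral_congr_ae ?_
  filter_upwards [hf.coeFn_toLp] with t ht
  rw [ht]

theorem integrable_mFourier_mul {f : UnitAddTorus ι → ℂ} (hf : MemLp f 2 volume) (k : ι → ℤ) :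
    Integrable (fun t => f t * UnitAddTorus.mFourier k t) volume := by
  have : IsProbabilityMeasure (volume : Measure UnitAddCircle) :=
    inferInstanceAs (IsProbabilityMeasure AddCircle.haarAddCircle)
  refine (hf.integrable (by norm_num)).mul_bdd (c := 1)
    (UnitAddTorus.mFourier k).continuous.aestronglyMeasurable (.of_forall fun t => ?_)
  exact ((UnitAddTorus.mFourier k).norm_coe_le_norm t).trans UnitAddTorus.mFourier_norm.le

/-- Integer samples of a Fourier transform are Fourier coefficients of the periodization. The index
is `-k` because `mFourierCoeff` integrates against the conjugate character. -/
theorem integral_mul_fourierChar_eq_mFourierCoeff [DecidableEq ι] {F : (ι → ℝ) → ℂ} {R : ℝ}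
    (hF : MemLp F 2 volume) (hF1 : Integrable F volume) (hR : ∀ x, F x ≠ 0 → ‖x‖ ≤ R)
    (k : ι → ℤ) :
    ∫ x, F x * (𝐞 (∑ i, (k i : ℝ) * x i) : ℂ) =
      UnitAddTorus.mFourierCoeff (fun t => ∑ n ∈ intBox ι (⌈R⌉ + 1),
        F (torusSection 0 t + fun i => (n i : ℝ))) (-k) := by
  have hcont : Continuous fun x : ι → ℝ => (𝐞 (∑ i, (k i : ℝ) * x i) : ℂ) :=
    continuous_subtype_val.comp (Real.continuous_fourierChar.comp (by fun_prop))
  have h1 : Integrable (fun x => F x * (𝐞 (∑ i, (k i : ℝ) * x i) : ℂ)) volume :=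
    hF1.mul_bdd (c := 1) hcont.aestronglyMeasurable (.of_forall fun x => (Circle.norm_coe _).le)
  rw [← (hasSum_integral_torusSection h1).tsum_eq, tsum_eq_sum (s := intBox ι (⌈R⌉ + 1))]
  · simp only [UnitAddTorus.mFourierCoeff, neg_neg, smul_eq_mul, Finset.mul_sum]
    rw [integral_finsetSum]
    · refine Finset.sum_congr rfl fun n _ => integral_congr_ae (.of_forall fun t => ?_)
      simp only [Pi.add_apply, mFourier_eq_fourierChar]
      ring
    · intro n _
      simpa only [mul_comm] using integrable_mFourier_mul (memLp_comp_torusSection hF n) k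
  · intro n hn
    simp [apply_torusSection_eq_zero hR hn]

/-- **Parseval's identity** for the integer samples of the Fourier transforms of two square
integrable functions of bounded support. -/
theorem hasSum_integer_samples {F G : (ι → ℝ) → ℂ} {R : ℝ}
    (hF : MemLp F 2 volume) (hG : MemLp G 2 volume)
    (hF1 : Integrable F volume) (hG1 : Integrable G volume)
    (hFR : ∀ x, F x ≠ 0 → ‖x‖ ≤ R) (hGR : ∀ x, G x ≠ 0 → ‖x‖ ≤ R) :
    HasSum (fun k : ι → ℤ => (∫ x, F x * (𝐞 (∑ i, (k i : ℝ) * x i) : ℂ)) *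
        (starRingEnd ℂ) (∫ x, G x * (𝐞 (∑ i, (k i : ℝ) * x i) : ℂ)))
      (∑' n : ι → ℤ, ∫ x, F x * (starRingEnd ℂ) (G (x + fun i => (n i : ℝ)))) := by
  classical
  set S := intBox ι (⌈R⌉ + 1) with hS
  let Fn : (ι → ℤ) → UnitAddTorus ι → ℂ := fun n t => F (torusSection 0 t + fun i => (n i : ℝ))
  let Gn : (ι → ℤ) → UnitAddTorus ι → ℂ := fun n t => G (torusSection 0 t + fun i => (n i : ℝ))
  have hFn : ∀ n, MemLp (Fn n) 2 volume := memLp_comp_torusSection hF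
  have hGn : ∀ n, MemLp (Gn n) 2 volume := memLp_comp_torusSection hG
  have hFS : MemLp (fun t => ∑ n ∈ S, Fn n t) 2 volume := memLp_finsetSum S fun n _ => hFn n
  have hGS : MemLp (fun t => ∑ n ∈ S, Gn n t) 2 volume := memLp_finsetSum S fun n _ => hGn n
  have hint : ∀ m n, Integrable (fun t => Fn m t * (starRingEnd ℂ) (Gn n t)) volume :=
    fun m n => (hFn m).integrable_mul (hGn n).star
  have hP := UnitAddTorus.hasSum_prod_mFourierCoeff (hGS.toLp _) (hFS.toLp _)
  rw [← (Equiv.neg (ι → ℤ)).hasSum_iff] at hP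
  have hRHS : HasSum (fun n : ι → ℤ => ∫ x, F x * (starRingEnd ℂ) (G (x + fun i => (n i : ℝ))))
      (∑ m ∈ S, ∑ n ∈ S, ∫ t, Fn m t * (starRingEnd ℂ) (Gn n t)) := by
    -- Only finitely many boxes meet the support of `F`; on the box `m`, the shift by `n` moves the
    -- argument of `G` into the box `m + n`.
    have h1 : ∀ n : ι → ℤ, ∫ x, F x * (starRingEnd ℂ) (G (x + fun i => (n i : ℝ))) =
        ∑ m ∈ S, ∫ t, Fn m t * (starRingEnd ℂ) (Gn (m + n) t) := by
      intro n
      have hGt : MemLp (fun x => G (x + fun i => (n i : ℝ))) 2 volume :=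
        hG.comp_measurePreserving (measurePreserving_add_right volume _)
      have h2 : Integrable (fun x => F x * (starRingEnd ℂ) (G (x + fun i => (n i : ℝ)))) volume :=
        hF.integrable_mul hGt.star
      rw [← (hasSum_integral_torusSection h2).tsum_eq, tsum_eq_sum (s := S)]
      · refine Finset.sum_congr rfl fun m _ => integral_congr_ae (.of_forall fun t => ?_)
        simp only [Fn, Gn, add_assoc]
        congr 4
        funext i
        simp
      · intro m hm
        simp [apply_torusSection_eq_zero hFR hm]
    simp only [h1]
    refine hasSum_sum fun m _ => ?_
    -- Replacing `n` by `n - m` decouples the two box indices, and the sum over `n` becomes finite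
    -- by the support of `G`.
    rw [← (Equiv.addLeft (-m)).hasSum_iff]
    simp only [Function.comp_def, Equiv.coe_addLeft, add_neg_cancel_left]
    refine hasSum_sum_of_ne_finset_zero fun n hn => ?_
    simp [Gn, apply_torusSection_eq_zero hGR hn]
  rw [hRHS.tsum_eq]
  convert hP using 1
  · funext k
    simp only [Function.comp, Equiv.neg_apply]
    rw [mFourierCoeff_toLp_of_memLp, mFourierCoeff_toLp_of_memLp,
      integral_mul_fourierChar_eq_mFourierCoeff hF hF1 hFR,
      integral_mul_fourierChar_eq_mFourierCoeff hG hG1 hGR, mul_comm]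
  · have : ∫ t, (starRingEnd ℂ) (hGS.toLp _ t) * hFS.toLp _ t =
        ∫ t, ∑ m ∈ S, ∑ n ∈ S, Fn m t * (starRingEnd ℂ) (Gn n t) := by
      refine integral_congr_ae ?_
      filter_upwards [hGS.coeFn_toLp, hFS.coeFn_toLp] with t h1 h2
      rw [h1, h2, map_sum, mul_comm, Finset.sum_mul_sum]
    rw [this, integral_finsetSum _ fun m _ => integrable_finsetSum _ fun n _ => hint m n]
    exact Finset.sum_congr rfl fun m _ => (integral_finsetSum _ fun n _ => hint m n).symm

end Torus

/-! ### Transfer of Parseval's identity from `ℤᵈ` to `C ℤᵈ` by the substitution `ξ = C' η`. -/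

section Lattice

variable {d : ℕ} {C : Matrix (Fin d) (Fin d) ℝ}

theorem latticePoint_add (C : Matrix (Fin d) (Fin d) ℝ) (k l : Fin d → ℤ) :
    latticePoint C (k + l) = latticePoint C k + latticePoint C l := by
  rw [latticePoint, latticePoint, latticePoint, ← WithLp.toLp_add, ← Matrix.mulVec_add]
  congr 2
  funext i
  simp

@[simp]
theorem latticePoint_zero (C : Matrix (Fin d) (Fin d) ℝ) : latticePoint C 0 = 0 := by
  have := latticePoint_add C 0 0
  simpa using this

theorem latticePoint_neg (C : Matrix (Fin d) (Fin d) ℝ) (k : Fin d → ℤ) :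
    latticePoint C (-k) = -latticePoint C k := by
  rw [eq_neg_iff_add_eq_zero, ← latticePoint_add, neg_add_cancel, latticePoint_zero]

/-- The parametrization `η ↦ C' η` of `ℝᵈ`. -/
noncomputable def dualParam (C : Matrix (Fin d) (Fin d) ℝ) (η : Fin d → ℝ) : Rd d :=
  WithLp.toLp 2 (contragredient C *ᵥ η)

theorem transpose_mulVec_dualParam (hC : IsUnit C.det) (η : Fin d → ℝ) :
    Cᵀ *ᵥ (dualParam C η).ofLp = η := by
  have hC' : IsUnit (Cᵀ).det := by rwa [Matrix.det_transpose]
  simp [dualParam, contragredient, Matrix.mulVec_mulVec, Matrix.mul_nonsing_inv _ hC']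

theorem inner_latticePoint_dualParam (hC : IsUnit C.det) (k : Fin d → ℤ) (η : Fin d → ℝ) :
    inner ℝ (latticePoint C k) (dualParam C η) = ∑ i, (k i : ℝ) * η i := by
  have h : inner ℝ (latticePoint C k) (dualParam C η) =
      (dualParam C η).ofLp ⬝ᵥ (C *ᵥ fun i => (k i : ℝ)) := by
    simp [latticePoint, EuclideanSpace.inner_eq_star_dotProduct]
  rw [h, Matrix.dotProduct_mulVec, ← Matrix.mulVec_transpose, transpose_mulVec_dualParam hC,
    dotProduct_comm]
  rfl

theorem dualParam_add_intCast (η : Fin d → ℝ) (n : Fin d → ℤ) :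
    dualParam C (η + fun i => (n i : ℝ)) = dualParam C η + latticePoint (contragredient C) n := by
  simp [dualParam, latticePoint, Matrix.mulVec_add]

theorem measurableEmbedding_dualParam (hC : IsUnit C.det) :
    MeasurableEmbedding (dualParam C) := by
  refine Measurable.measurableEmbedding ?_ ?_
  · have : Continuous (dualParam C) := by unfold dualParam; fun_prop
    exact this.measurable
  · intro x y hxy
    rw [← transpose_mulVec_dualParam hC x, hxy, transpose_mulVec_dualParam hC]

theorem map_dualParam_volume (hC : IsUnit C.det) :
    Measure.map (dualParam C) volume = ENNReal.ofReal |C.det| • volume := by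
  have hdet : (contragredient C).det = C.det⁻¹ := by
    simp [contragredient, Matrix.det_nonsing_inv]
  have h0 : (contragredient C).det ≠ 0 := by
    rw [hdet]; exact inv_ne_zero hC.ne_zero
  have h1 : dualParam C = WithLp.toLp 2 ∘ Matrix.toLin' (contragredient C) := by
    funext η; simp [dualParam]
  rw [h1, ← Measure.map_map (PiLp.volume_preserving_toLp (Fin d)).measurable
    (Matrix.toLin' (contragredient C)).continuous_of_finiteDimensional.measurable,
    Real.map_matrix_volume_pi_eq_smul_volume_pi h0, Measure.map_smul,
    (PiLp.volume_preserving_toLp (Fin d)).map_eq, hdet, inv_inv]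

theorem integral_comp_dualParam (hC : IsUnit C.det) (φ : Rd d → ℂ) :
    ∫ η, φ (dualParam C η) = (|C.det| : ℝ) * ∫ ξ, φ ξ := by
  rw [← (measurableEmbedding_dualParam hC).integral_map, map_dualParam_volume hC,
    integral_smul_measure, ENNReal.toReal_ofReal (abs_nonneg _)]
  simp

theorem MeasureTheory.MemLp.comp_dualParam (hC : IsUnit C.det) {φ : Rd d → ℂ} {p : ℝ≥0∞}
    (hφ : MemLp φ p volume) : MemLp (fun η => φ (dualParam C η)) p volume := by
  refine (measurableEmbedding_dualParam hC).memLp_map_measure_iff.1 ?_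
  rw [map_dualParam_volume hC]
  exact hφ.smul_measure ENNReal.ofReal_ne_top

theorem exists_norm_le_of_dualParam (hC : IsUnit C.det) {φ : Rd d → ℂ} {R : ℝ}
    (hφ : ∀ ξ, φ ξ ≠ 0 → ‖ξ‖ ≤ R) : ∃ R', ∀ η, φ (dualParam C η) ≠ 0 → ‖η‖ ≤ R' := by
  let A : Rd d →L[ℝ] (Fin d → ℝ) := LinearMap.toContinuousLinearMap
    (Matrix.toLin' Cᵀ ∘ₗ (WithLp.linearEquiv 2 ℝ (Fin d → ℝ)).toLinearMap)
  refine ⟨‖A‖ * R, fun η hη => ?_⟩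
  have h : A (dualParam C η) = η := transpose_mulVec_dualParam hC η
  calc ‖η‖ = ‖A (dualParam C η)‖ := by rw [h]
    _ ≤ ‖A‖ * ‖dualParam C η‖ := A.le_opNorm _
    _ ≤ ‖A‖ * R := mul_le_mul_of_nonneg_left (hφ _ hη) (norm_nonneg _)

/-- **Parseval's identity** for the samples at the lattice `C ℤᵈ` of the Fourier transforms of two
square integrable functions of bounded support. -/
theorem hasSum_lattice_samples (hC : IsUnit C.det) {F G : Rd d → ℂ} {R : ℝ}
    (hF : MemLp F 2 volume) (hG : MemLp G 2 volume)
    (hF1 : Integrable F volume) (hG1 : Integrable G volume)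
    (hFR : ∀ ξ, F ξ ≠ 0 → ‖ξ‖ ≤ R) (hGR : ∀ ξ, G ξ ≠ 0 → ‖ξ‖ ≤ R) :
    HasSum (fun k : Fin d → ℤ => (∫ ξ, F ξ * character (latticePoint C k) ξ) *
        (starRingEnd ℂ) (∫ ξ, G ξ * character (latticePoint C k) ξ))
      (∑' n : Fin d → ℤ, (|C.det|⁻¹ : ℝ) *
        ∫ ξ, F ξ * (starRingEnd ℂ) (G (ξ + latticePoint (contragredient C) n))) := by
  obtain ⟨R₁, h₁⟩ := exists_norm_le_of_dualParam hC hFR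
  obtain ⟨R₂, h₂⟩ := exists_norm_le_of_dualParam hC hGR
  have hd : (|C.det| : ℝ) ≠ 0 := abs_ne_zero.2 hC.ne_zero
  have hd' : ((|C.det| : ℝ) : ℂ) ≠ 0 := Complex.ofReal_ne_zero.2 hd
  have key := hasSum_integer_samples (R := max R₁ R₂) (hF.comp_dualParam hC) (hG.comp_dualParam hC)
    (memLp_one_iff_integrable.1 ((memLp_one_iff_integrable.2 hF1).comp_dualParam hC))
    (memLp_one_iff_integrable.1 ((memLp_one_iff_integrable.2 hG1).comp_dualParam hC))
    (fun x hx => (h₁ x hx).trans (le_max_left _ _)) (fun x hx => (h₂ x hx).trans (le_max_right _ _))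
  have hsample : ∀ (Φ : Rd d → ℂ) (k : Fin d → ℤ),
      ∫ x, Φ (dualParam C x) * (𝐞 (∑ i, (k i : ℝ) * x i) : ℂ) =
        (|C.det| : ℝ) * ∫ ξ, Φ ξ * character (latticePoint C k) ξ := by
    intro Φ k
    rw [← integral_comp_dualParam hC]
    simp only [character, inner_latticePoint_dualParam hC]
  simp only [hsample, dualParam_add_intCast] at key
  -- Each of the two samples acquires a factor `|det C|` from the substitution, and the correlation
  -- integral acquires one; division by `|det C|²` leaves `|det C|⁻¹`.
  have key' := key.mul_left ((((|C.det|⁻¹ : ℝ) : ℂ)) ^ 2)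
  rw [← tsum_mul_left] at key'
  have hsum : ∀ n : Fin d → ℤ, ((|C.det|⁻¹ : ℝ) : ℂ) ^ 2 * ∫ x, F (dualParam C x) *
      (starRingEnd ℂ) (G (dualParam C x + latticePoint (contragredient C) n)) =
      (|C.det|⁻¹ : ℝ) * ∫ ξ, F ξ * (starRingEnd ℂ) (G (ξ + latticePoint (contragredient C) n)) := by
    intro n
    rw [integral_comp_dualParam hC
      fun ξ => F ξ * (starRingEnd ℂ) (G (ξ + latticePoint (contragredient C) n))]
    push_cast
    field_simp
  simp only [hsum] at key'
  refine key'.congr_fun fun k => ?_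
  rw [map_mul, Complex.conj_ofReal]
  push_cast
  field_simp

end Lattice

/-! ### The coefficients of a single translation-invariant layer -/

section Layer

variable {d : ℕ}

theorem integrable_indicator_of_memLp {E : Set (Rd d)} (hE : MeasurableSet E)
    (hE' : volume E ≠ ∞) {φ : Rd d → ℂ} (hφ : MemLp φ 2 volume) :
    Integrable (E.indicator φ) volume := by
  have : IsFiniteMeasure (volume.restrict E) := ⟨by simpa using hE'.lt_top⟩
  exact (integrable_indicator_iff hE).2 ((hφ.restrict E).integrable (by norm_num))

theorem integrable_character_mul (x : Rd d) {φ : Rd d → ℂ} (hφ : Integrable φ volume) :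
    Integrable (fun ξ => character x ξ * φ ξ) volume :=
  hφ.bdd_mul (c := 1) (continuous_character x).aestronglyMeasurable
    (.of_forall fun ξ => (norm_character x ξ).le)

/-- By Plancherel, a frame coefficient is a lattice sample, in the shape that
`hasSum_lattice_samples` takes. -/
theorem inner_translation_bandlimited {E : Set (Rd d)} (hE : MeasurableSet E)
    (hE' : volume E ≠ ∞) (x y : Rd d) (f : L2Rd d) :
    inner ℂ (translation y f) (translation x (bandlimited hE hE')) =
      ∫ ξ, character (-x) ξ * E.indicator (fun ξ => (starRingEnd ℂ) (fhat f ξ)) ξ *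
        character y ξ := by
  rw [inner_eq_integral_fhat]
  refine integral_congr_ae ?_
  filter_upwards [fhat_translation y f, fhat_translation x (bandlimited hE hE'),
    fhat_bandlimited hE hE'] with ξ h1 h2 h3
  rw [h1, h2, h3, map_mul, conj_character, character_neg_left, neg_neg]
  by_cases h : ξ ∈ E
  · simp [h]; ring
  · simp [h]

/-- The points `ξ` of `E` with `ξ + α` in `E'`. -/
def overlap (E E' : Set (Rd d)) (α : Rd d) : Set (Rd d) := {ξ | ξ ∈ E ∧ ξ + α ∈ E'}

theorem measurableSet_overlap {E E' : Set (Rd d)} (hE : MeasurableSet E) (hE' : MeasurableSet E')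
    (α : Rd d) : MeasurableSet (overlap E E' α) :=
  hE.inter (hE'.preimage (measurable_add_const α))

theorem hasSum_layer {P : Type*} (C : P → Matrix (Fin d) (Fin d) ℝ) (g h : P → L2Rd d) (p : P)
    (hC : IsUnit (C p).det) {E E' : Set (Rd d)} {R : ℝ} (hE : MeasurableSet E)
    (hE' : MeasurableSet E') (hEv : volume E ≠ ∞) (hEv' : volume E' ≠ ∞)
    (hER : ∀ ξ ∈ E, ‖ξ‖ ≤ R) (hER' : ∀ ξ ∈ E', ‖ξ‖ ≤ R) (x : Rd d) :
    HasSum (fun k : Fin d → ℤ =>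
        inner ℂ (translation (latticePoint (C p) k) (h p)) (translation x (bandlimited hE hEv)) *
        inner ℂ (translation x (bandlimited hE' hEv')) (translation (latticePoint (C p) k) (g p)))
      (∑' m : Fin d → ℤ,
        (∫ ξ in overlap E E' (latticePoint (contragredient (C p)) m),
          symbolTerm C g h (latticePoint (contragredient (C p)) m) p ξ) *
        character x (latticePoint (contragredient (C p)) m)) := by
  have hmem : ∀ (f : L2Rd d) {D : Set (Rd d)}, MeasurableSet D →
      MemLp (D.indicator fun ξ => (starRingEnd ℂ) (fhat f ξ)) 2 volume :=
    fun f D hD => (memLp_fhat f).star.indicator hD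
  have hint : ∀ (f : L2Rd d) {D : Set (Rd d)}, MeasurableSet D → volume D ≠ ∞ →
      Integrable (D.indicator fun ξ => (starRingEnd ℂ) (fhat f ξ)) volume :=
    fun f D hD hD' => integrable_indicator_of_memLp hD hD' (memLp_fhat f).star
  have hsupp : ∀ (f : L2Rd d) {D : Set (Rd d)}, (∀ ξ ∈ D, ‖ξ‖ ≤ R) → ∀ ξ,
      character (-x) ξ * D.indicator (fun ξ => (starRingEnd ℂ) (fhat f ξ)) ξ ≠ 0 → ‖ξ‖ ≤ R := by
    intro f D hD ξ hξ
    refine hD ξ ?_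
    by_contra h
    simp [h] at hξ
  have key := hasSum_lattice_samples hC (memLp_character_mul (-x) (hmem (h p) hE))
    (memLp_character_mul (-x) (hmem (g p) hE')) (integrable_character_mul (-x) (hint (h p) hE hEv))
    (integrable_character_mul (-x) (hint (g p) hE' hEv')) (hsupp (h p) hER) (hsupp (g p) hER')
  have hcoef : ∀ m : Fin d → ℤ, ((|(C p).det|⁻¹ : ℝ) : ℂ) *
      ∫ ξ, character (-x) ξ * E.indicator (fun ξ => (starRingEnd ℂ) (fhat (h p) ξ)) ξ *
        (starRingEnd ℂ) (character (-x) (ξ + latticePoint (contragredient (C p)) m) *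
          E'.indicator (fun ξ => (starRingEnd ℂ) (fhat (g p) ξ))
            (ξ + latticePoint (contragredient (C p)) m)) =
      (∫ ξ in overlap E E' (latticePoint (contragredient (C p)) m),
          symbolTerm C g h (latticePoint (contragredient (C p)) m) p ξ) *
        character x (latticePoint (contragredient (C p)) m) := by
    intro m
    set α := latticePoint (contragredient (C p)) m
    rw [← integral_indicator (measurableSet_overlap hE hE' α), ← integral_const_mul,
      ← integral_mul_const]
    refine integral_congr_ae (.of_forall fun ξ => ?_)
    -- The modulations at `ξ` and `ξ + α` cancel up to a factor independent of `ξ`; this is the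
    -- character through which `x` enters the layer.
    have hch : character (-x) ξ * character x (ξ + α) = character x α := by
      rw [character_neg_left, ← character_add_right, neg_add_cancel_left]
    by_cases h1 : ξ ∈ E
    · by_cases h2 : ξ + α ∈ E'
      · have h3 : ξ ∈ overlap E E' α := ⟨h1, h2⟩
        simp only [Set.indicator_of_mem, h1, h2, h3, symbolTerm, map_mul, RingHomCompTriple.comp_apply,
          RingHom.id_apply]
        rw [conj_character, character_neg_left x (-(ξ + α)), neg_neg, ← hch]
        ring
      · have h3 : ξ ∉ overlap E E' α := fun h => h2 h.2
        simp [h2, h3]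
    · have h3 : ξ ∉ overlap E E' α := fun h => h1 h.1
      simp [h1, h3]
  simp only [hcoef] at key
  refine key.congr_fun fun k => ?_
  rw [← inner_translation_bandlimited hE hEv, ← inner_translation_bandlimited hE' hEv',
    inner_conj_symm]

end Layer

/-! ### Uniqueness for absolutely convergent series of characters -/

section Uniqueness

variable {d : ℕ}

theorem integral_gaussian_mul_character {b : ℝ} (hb : 0 < b) (α : Rd d) :
    ∫ x : Rd d, Complex.exp (-b * (‖x‖ : ℂ) ^ 2) * character x α =
      (Real.pi / b : ℂ) ^ ((Module.finrank ℝ (Rd d) : ℂ) / 2) *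
        (Real.exp (-(Real.pi ^ 2 * ‖α‖ ^ 2 / b)) : ℂ) := by
  have h := GaussianFourier.integral_cexp_neg_mul_sq_norm_add (b := (b : ℂ)) (by simpa using hb)
    (2 * Real.pi * Complex.I) α
  have hexp : (2 * Real.pi * Complex.I) ^ 2 * (‖α‖ : ℂ) ^ 2 / (4 * b) =
      ((-(Real.pi ^ 2 * ‖α‖ ^ 2 / b) : ℝ) : ℂ) := by
    push_cast
    rw [mul_pow, mul_pow, Complex.I_sq]
    have : (b : ℂ) ≠ 0 := Complex.ofReal_ne_zero.2 hb.ne'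
    field_simp
    ring
  rw [hexp, ← Complex.ofReal_exp] at h
  rw [← h]
  refine integral_congr_ae (.of_forall fun x => ?_)
  simp only [character, Real.fourierChar_apply]
  rw [← Complex.exp_add, real_inner_comm]
  congr 1
  push_cast
  ring

theorem integrable_gaussian_mul_character {b : ℝ} (hb : 0 < b) (α : Rd d) :
    Integrable (fun x : Rd d => Complex.exp (-b * (‖x‖ : ℂ) ^ 2) * character x α) := by
  have h := GaussianFourier.integrable_cexp_neg_mul_sq_norm_add (b := (b : ℂ)) (by simpa using hb)
    (2 * Real.pi * Complex.I) α
  refine h.congr (.of_forall fun x => ?_)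
  simp only [character, Real.fourierChar_apply]
  rw [← Complex.exp_add, real_inner_comm]
  congr 1
  push_cast
  ring

/-- If an absolutely convergent series of characters of `ℝᵈ` is constant, its value is the sum of
the coefficients of the trivial character. -/
theorem tsum_trivial_character_eq {ι : Type*} [Countable ι] {c : ι → ℂ}
    (hc : Summable fun i => ‖c i‖) (α : ι → Rd d) {K : ℂ}
    (hK : ∀ x, ∑' i, c i * character x (α i) = K) :
    ∑' i, {i | α i = 0}.indicator c i = K := by
  -- Integration against a Gaussian damps the character at `α` by `exp(-π²‖α‖²/b)` relative to the
  -- trivial one. The common normalization `N` cancels.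
  have hmean : ∀ b : ℝ, 0 < b →
      ∑' i, c i * (Real.exp (-(Real.pi ^ 2 * ‖α i‖ ^ 2 / b)) : ℂ) = K := by
    intro b hb
    obtain ⟨N, hN0, hN⟩ : ∃ N : ℂ, N ≠ 0 ∧ ∀ β : Rd d,
        ∫ x : Rd d, Complex.exp (-b * (‖x‖ : ℂ) ^ 2) * character x β =
          N * (Real.exp (-(Real.pi ^ 2 * ‖β‖ ^ 2 / b)) : ℂ) := by
      refine ⟨_, ?_, integral_gaussian_mul_character hb⟩
      rw [Complex.cpow_ne_zero_iff]
      left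
      exact div_ne_zero (Complex.ofReal_ne_zero.2 Real.pi_ne_zero) (Complex.ofReal_ne_zero.2 hb.ne')
    have hint : ∀ i, Integrable (fun x : Rd d =>
        c i * (Complex.exp (-b * (‖x‖ : ℂ) ^ 2) * character x (α i))) :=
      fun i => (integrable_gaussian_mul_character hb (α i)).const_mul _
    have hsum := (hasSum_integral_of_summable_integral_norm hint (by
      simp only [norm_mul, norm_character, mul_one, integral_const_mul]
      exact hc.mul_right _)).tsum_eq
    have h1 : ∀ x : Rd d, ∑' i, c i * (Complex.exp (-b * (‖x‖ : ℂ) ^ 2) * character x (α i)) =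
        K * (Complex.exp (-b * (‖x‖ : ℂ) ^ 2) * character x 0) := by
      intro x
      rw [← hK x, character_zero_right, mul_one, ← tsum_mul_right]
      exact tsum_congr fun i => by ring
    simp only [h1, integral_const_mul, hN] at hsum
    have h2 : ∀ i, c i * (N * (Real.exp (-(Real.pi ^ 2 * ‖α i‖ ^ 2 / b)) : ℂ)) =
        N * (c i * (Real.exp (-(Real.pi ^ 2 * ‖α i‖ ^ 2 / b)) : ℂ)) := fun i => by ring
    simp only [h2, tsum_mul_left] at hsum
    refine mul_left_cancel₀ hN0 (hsum.trans ?_)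
    simp [mul_comm]
  -- With `b = 1/(n+1) → 0`, only the terms with `α i = 0` survive, by dominated convergence.
  have hlim : Filter.Tendsto
      (fun n : ℕ => ∑' i, c i * (Real.exp (-(Real.pi ^ 2 * ‖α i‖ ^ 2 / (1 / ((n : ℝ) + 1)))) : ℂ))
      Filter.atTop (𝓝 (∑' i, {i | α i = 0}.indicator c i)) := by
    refine tendsto_tsum_of_dominated_convergence hc (fun i => ?_) (.of_forall fun n i => ?_)
    · by_cases hi : α i = 0
      · simp [hi]
      · have hpos : 0 < Real.pi ^ 2 * ‖α i‖ ^ 2 := by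
          have := norm_pos_iff.2 hi
          have := Real.pi_pos
          positivity
        have h1 : Filter.Tendsto (fun n : ℕ => Real.pi ^ 2 * ‖α i‖ ^ 2 / (1 / ((n : ℝ) + 1)))
            Filter.atTop Filter.atTop := by
          simp only [div_div_eq_mul_div, div_one]
          exact (Filter.tendsto_atTop_add_const_right _ 1
            tendsto_natCast_atTop_atTop).const_mul_atTop hpos
        have h2 := Real.tendsto_exp_neg_atTop_nhds_zero.comp h1
        have h3 := (Complex.continuous_ofReal.tendsto 0).comp h2
        simpa [hi] using h3.const_mul (c i)
    · rw [norm_mul, Complex.norm_real, Real.norm_eq_abs, Real.abs_exp]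
      refine mul_le_of_le_one_right (norm_nonneg _) (Real.exp_le_one_iff.2 ?_)
      rw [neg_nonpos]
      positivity
  refine tendsto_nhds_unique hlim (tendsto_const_nhds.congr fun n => ?_)
  exact (hmean _ (by positivity)).symm

end Uniqueness

/-! ### Consequences of local integrability -/

section LocalIntegrability

variable {d : ℕ} {P : Type*}

/-- Openness of `A` is essential: an open set that meets `A` then meets it in positive measure. -/
theorem essSupport_of_ae_eq_indicator {F : Rd d → ℂ} {A : Set (Rd d)} (hA : IsOpen A)
    (hF : F =ᵐ[volume] A.indicator 1) : essSupport F = closure A := by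
  have key : ∀ U : Set (Rd d), volume {η | η ∈ U ∧ F η ≠ 0} = volume (U ∩ A) := by
    intro U
    refine measure_congr ?_
    filter_upwards [hF] with η hη
    refine propext ?_
    change (η ∈ U ∧ F η ≠ 0) ↔ (η ∈ U ∧ η ∈ A)
    rw [hη]
    simp
  ext ξ
  simp only [essSupport, Set.mem_ofPred_eq, key, mem_closure_iff_nhds]
  refine ⟨fun h U hU => nonempty_of_measure_ne_zero (h U hU).ne', fun h U hU => ?_⟩
  have h1 : (interior U ∩ A).Nonempty := h _ (interior_mem_nhds.2 hU)
  exact ((isOpen_interior.inter hA).measure_pos volume h1).trans_le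
    (measure_mono (Set.inter_subset_inter_left _ interior_subset))

/-- The local integrability condition tested on the indicator function of `A`. -/
def LocalBound (C : P → Matrix (Fin d) (Fin d) ℝ) (g : P → L2Rd d) (A : Set (Rd d)) : Prop :=
  ∑' (p : P) (k : Fin d → ℤ), ∫⁻ ξ in overlap A A (latticePoint (contragredient (C p)) k),
    ENNReal.ofReal (|(C p).det|⁻¹) * ‖fhat (g p) ξ‖ₑ ^ 2 < ∞

theorem LocallyIntegrableSystem.localBound {C : P → Matrix (Fin d) (Fin d) ℝ} {g : P → L2Rd d}
    (hg : LocallyIntegrableSystem C g) {A : Set (Rd d)} (hA : IsOpen A)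
    (hAb : Bornology.IsBounded A) {r : ℝ} (hr : 0 < r) (hAr : ∀ ξ ∈ A, r ≤ ‖ξ‖) :
    LocalBound C g A := by
  have hAv : volume A ≠ ∞ := hAb.measure_lt_top.ne
  set f := bandlimited hA.measurableSet hAv with hf
  have hfA : fhat f =ᵐ[volume] A.indicator 1 := fhat_bandlimited _ _
  have hess := essSupport_of_ae_eq_indicator hA hfA
  have hmem : f ∈ testSpace d := by
    refine ⟨?_, ?_, r, hr, fun ξ hξ => ?_⟩
    · refine MemLp.ae_eq hfA.symm ?_
      exact (memLp_top_const (1 : ℂ)).indicator hA.measurableSet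
    · rw [hess]
      exact Metric.isCompact_of_isClosed_isBounded isClosed_closure hAb.closure
    · rw [hess] at hξ
      have hcl : IsClosed {η : Rd d | r ≤ ‖η‖} := isClosed_le continuous_const continuous_norm
      exact closure_minimal (s := A) hAr hcl hξ
  refine lt_of_le_of_lt ?_ (hg f hmem)
  refine ENNReal.tsum_le_tsum fun p => ENNReal.tsum_le_tsum fun k => ?_
  set α := latticePoint (contragredient (C p)) k
  have hsub : overlap A A α ⊆ essSupport (fhat f) := fun ξ hξ => hess ▸ subset_closure hξ.1
  refine le_trans (le_of_eq ?_) (lintegral_mono_set hsub)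
  refine setLIntegral_congr_fun_ae (measurableSet_overlap hA.measurableSet hA.measurableSet α) ?_
  have hshift := (measurePreserving_add_right volume α).quasiMeasurePreserving.ae_eq_comp hfA
  filter_upwards [hshift] with ξ hξ hξA
  simp only [Function.comp] at hξ
  rw [hξ]
  simp [hξA.2]

/-- In dimension zero the only point is `0`, so the test space is trivial and local integrability
says nothing. The Bessel bound replaces it: Lebesgue measure is a Dirac mass, and the coefficients
of the function with transform `1` are the conjugates of `ĝ_p(0)`. -/
theorem IsBessel.localBound_univ {C : P → Matrix (Fin 0) (Fin 0) ℝ} {g : P → L2Rd 0}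
    (hg : IsBessel (translationSystem C g)) : LocalBound C g Set.univ := by
  obtain ⟨M, hM⟩ := hg
  have hvol : (volume : Measure (Rd 0)) = Measure.dirac 0 :=
    volume_euclideanSpace_eq_dirac (Fin 0)
  have hfin : volume (Set.univ : Set (Rd 0)) ≠ ∞ := by rw [hvol]; simp
  have h1 := (hM (translation 0 (bandlimited MeasurableSet.univ hfin))).1.tsum_ofReal_ne_top
  refine lt_of_le_of_lt (le_of_eq ?_) h1.lt_top
  rw [← ENNReal.tsum_prod]
  refine tsum_congr fun q => ?_
  rw [translationSystem, inner_translation_bandlimited, hvol, integral_dirac]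
  have h2 : overlap (Set.univ : Set (Rd 0)) Set.univ
      (latticePoint (contragredient (C q.1)) q.2) = Set.univ := by ext; simp [overlap]
  rw [h2, Measure.restrict_univ, lintegral_dirac]
  simp [Matrix.det_isEmpty, ENNReal.ofReal_pow]

/-- An exhaustion of `ℝᵈ ∖ {0}` by open shells; for `d = 0` all shells are the whole space. -/
def shell (d n : ℕ) : Set (Rd d) :=
  {ξ | d = 0 ∨ (1 / ((n : ℝ) + 1) < ‖ξ‖ ∧ ‖ξ‖ < n + 1)}

theorem isOpen_shell (d n : ℕ) : IsOpen (shell d n) := by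
  refine isOpen_const.union ?_
  exact (isOpen_lt continuous_const continuous_norm).inter
    (isOpen_lt continuous_norm continuous_const)

theorem shell_mono (d : ℕ) : Monotone (shell d) := by
  intro m n hmn ξ hξ
  have h : (m : ℝ) ≤ n := by exact_mod_cast hmn
  refine hξ.imp_right fun h1 => ⟨?_, h1.2.trans_le (by linarith)⟩
  exact (one_div_le_one_div_of_le (by positivity) (by linarith)).trans_lt h1.1

theorem norm_le_of_mem_shell {n : ℕ} {ξ : Rd d} (hξ : ξ ∈ shell d n) : ‖ξ‖ ≤ n + 1 := by
  rcases hξ with h | h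
  · subst h
    rw [Subsingleton.elim ξ 0, norm_zero]
    positivity
  · exact h.2.le

theorem volume_shell_ne_top (d n : ℕ) : volume (shell d n) ≠ ∞ :=
  (isBounded_iff_forall_norm_le.2 ⟨_, fun _ h => norm_le_of_mem_shell h⟩).measure_lt_top.ne

theorem ae_exists_mem_shell (d : ℕ) : ∀ᵐ ξ : Rd d, ∃ n, ξ ∈ shell d n := by
  rcases Nat.eq_zero_or_pos d with h | h
  · exact .of_forall fun ξ => ⟨0, Or.inl h⟩
  · have : Nonempty (Fin d) := ⟨⟨0, h⟩⟩
    have h0 : ∀ᵐ ξ : Rd d, ξ ≠ 0 := Measure.ae_ne volume 0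
    filter_upwards [h0] with ξ hξ
    have hpos := norm_pos_iff.2 hξ
    obtain ⟨n, hn⟩ := exists_nat_one_div_lt hpos
    obtain ⟨m, hm⟩ := exists_nat_gt ‖ξ‖
    refine ⟨max n m, Or.inr ⟨?_, ?_⟩⟩
    · refine (one_div_le_one_div_of_le (by positivity) ?_).trans_lt hn
      have : (n : ℝ) ≤ (max n m : ℕ) := by exact_mod_cast le_max_left n m
      linarith
    · have : (m : ℝ) ≤ (max n m : ℕ) := by exact_mod_cast le_max_right n m
      linarith

theorem ae_exists_mem_overlap_shell (α : Rd d) :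
    ∀ᵐ ξ : Rd d, ∃ n, ξ ∈ overlap (shell d n) (shell d n) α := by
  have h := (measurePreserving_add_right volume α).quasiMeasurePreserving.ae (ae_exists_mem_shell d)
  filter_upwards [ae_exists_mem_shell d, h] with ξ ⟨m, hm⟩ ⟨n, hn⟩
  exact ⟨max m n, shell_mono d (le_max_left _ _) hm, shell_mono d (le_max_right _ _) hn⟩

theorem localBound_shell {C : P → Matrix (Fin d) (Fin d) ℝ} {g : P → L2Rd d}
    (hg : IsBessel (translationSystem C g)) (hgL : LocallyIntegrableSystem C g) (n : ℕ) :
    LocalBound C g (shell d n) := by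
  rcases Nat.eq_zero_or_pos d with h | h
  · subst h
    have : shell 0 n = Set.univ := Set.eq_univ_of_forall fun ξ => Or.inl rfl
    rw [this]
    exact hg.localBound_univ
  · refine hgL.localBound (isOpen_shell d n)
      (isBounded_iff_forall_norm_le.2 ⟨_, fun _ h => norm_le_of_mem_shell h⟩)
      (r := 1 / ((n : ℝ) + 1)) (by positivity) fun ξ hξ => ?_
    rcases hξ with h' | h'
    · exact absurd h' h.ne'
    · exact h'.1.le

end LocalIntegrability

/-! ### Summation of the symbol terms over shells -/

section Symbol

variable {d : ℕ} {P : Type*}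

/-- The point `C_p' k` of the dual lattices with index `(p, k)`. -/
noncomputable def dualPoint (C : P → Matrix (Fin d) (Fin d) ℝ) (i : P × (Fin d → ℤ)) : Rd d :=
  latticePoint (contragredient (C i.1)) i.2

theorem aestronglyMeasurable_symbolTerm (C : P → Matrix (Fin d) (Fin d) ℝ) (g h : P → L2Rd d)
    (α : Rd d) (p : P) : AEStronglyMeasurable (symbolTerm C g h α p) volume := by
  have h1 := aestronglyMeasurable_fhat (h p)
  have h2 := (aestronglyMeasurable_fhat (g p)).comp_measurePreserving
    (measurePreserving_add_right volume α)
  exact (aestronglyMeasurable_const.mul h1.star).mul h2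

/-- The bound `ab ≤ a² + b²` separates `h` from `g`, so that each local integrability condition can
be applied on its own. -/
theorem enorm_symbolTerm_le (C : P → Matrix (Fin d) (Fin d) ℝ) (g h : P → L2Rd d)
    (α : Rd d) (p : P) (ξ : Rd d) :
    ‖symbolTerm C g h α p ξ‖ₑ ≤ ENNReal.ofReal (|(C p).det|⁻¹) * ‖fhat (h p) ξ‖ₑ ^ 2 +
      ENNReal.ofReal (|(C p).det|⁻¹) * ‖fhat (g p) (ξ + α)‖ₑ ^ 2 := by
  have h1 : ‖(((|(C p).det|⁻¹ : ℝ)) : ℂ)‖ₑ = ENNReal.ofReal (|(C p).det|⁻¹) := by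
    rw [← ofReal_norm, Complex.norm_real, Real.norm_of_nonneg (by positivity)]
  have h2 : ∀ z : ℂ, ‖(starRingEnd ℂ) z‖ₑ = ‖z‖ₑ := fun z => by
    rw [← ofReal_norm, RCLike.norm_conj, ofReal_norm]
  rw [symbolTerm, enorm_mul, enorm_mul, h1, h2, mul_assoc, ← mul_add]
  gcongr
  rcases le_total ‖fhat (h p) ξ‖ₑ ‖fhat (g p) (ξ + α)‖ₑ with hle | hle
  · calc _ ≤ ‖fhat (g p) (ξ + α)‖ₑ * ‖fhat (g p) (ξ + α)‖ₑ := by gcongr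
      _ ≤ _ := by rw [← sq]; exact le_add_self
  · calc _ ≤ ‖fhat (h p) ξ‖ₑ * ‖fhat (h p) ξ‖ₑ := by gcongr
      _ ≤ _ := by rw [← sq]; exact le_self_add

theorem setLIntegral_overlap_comp_add {A : Set (Rd d)} (hA : MeasurableSet A) (α : Rd d)
    (φ : Rd d → ℝ≥0∞) :
    ∫⁻ ξ in overlap A A α, φ (ξ + α) = ∫⁻ ξ in overlap A A (-α), φ ξ := by
  rw [← lintegral_indicator (measurableSet_overlap hA hA _),
    ← lintegral_indicator (measurableSet_overlap hA hA _),
    ← lintegral_add_right_eq_self ((overlap A A (-α)).indicator φ) α]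
  refine lintegral_congr fun ξ => ?_
  have h : ξ + α ∈ overlap A A (-α) ↔ ξ ∈ overlap A A α := by
    simp [overlap, and_comm]
  by_cases hξ : ξ ∈ overlap A A α
  · rw [Set.indicator_of_mem hξ, Set.indicator_of_mem (h.2 hξ)]
  · rw [Set.indicator_of_notMem hξ, Set.indicator_of_notMem (fun h' => hξ (h.1 h'))]

theorem tsum_lintegral_symbolTerm_ne_top {C : P → Matrix (Fin d) (Fin d) ℝ} {g h : P → L2Rd d}
    {A : Set (Rd d)} (hA : MeasurableSet A) (hg : LocalBound C g A) (hh : LocalBound C h A) :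
    ∑' i : P × (Fin d → ℤ), ∫⁻ ξ in overlap A A (dualPoint C i),
      ‖symbolTerm C g h (dualPoint C i) i.1 ξ‖ₑ ≠ ∞ := by
  let u : L2Rd d → P → Rd d → ℝ≥0∞ :=
    fun f p ξ => ENNReal.ofReal (|(C p).det|⁻¹) * ‖fhat f ξ‖ₑ ^ 2
  have hu : ∀ f p, AEMeasurable (u f p) volume := fun f p =>
    ((aestronglyMeasurable_fhat f).enorm.pow_const 2).const_mul _
  have hle : ∀ i : P × (Fin d → ℤ), ∫⁻ ξ in overlap A A (dualPoint C i),
      ‖symbolTerm C g h (dualPoint C i) i.1 ξ‖ₑ ≤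
      (∫⁻ ξ in overlap A A (dualPoint C i), u (h i.1) i.1 ξ) +
        ∫⁻ ξ in overlap A A (-dualPoint C i), u (g i.1) i.1 ξ := by
    intro i
    rw [← setLIntegral_overlap_comp_add hA, ← lintegral_add_left' (hu _ _).restrict]
    exact lintegral_mono fun ξ => enorm_symbolTerm_le C g h _ i.1 ξ
  refine ne_top_of_le_ne_top ?_ (ENNReal.tsum_le_tsum hle)
  rw [ENNReal.tsum_add]
  refine ENNReal.add_ne_top.2 ⟨?_, ?_⟩
  · rw [ENNReal.tsum_prod (f := fun p k => ∫⁻ ξ in overlap A A (dualPoint C (p, k)), u (h p) p ξ)]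
    exact hh.ne
  · rw [ENNReal.tsum_prod (f := fun p k => ∫⁻ ξ in overlap A A (-dualPoint C (p, k)), u (g p) p ξ)]
    refine ne_of_eq_of_ne (tsum_congr fun p => ?_) hg.ne
    -- Translating the `g` term has replaced `α` by `-α`; the dual lattice is symmetric, so the sum
    -- over `k` is unaffected.
    rw [← (Equiv.neg (Fin d → ℤ)).tsum_eq]
    refine tsum_congr fun k => ?_
    simp [dualPoint, latticePoint_neg, u]

/-- The `(p, k)` coefficient of the correlation of two bandlimited functions. -/
noncomputable def coefficient (C : P → Matrix (Fin d) (Fin d) ℝ) (g h : P → L2Rd d)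
    (E E' : Set (Rd d)) (i : P × (Fin d → ℤ)) : ℂ :=
  ∫ ξ in overlap E E' (dualPoint C i), symbolTerm C g h (dualPoint C i) i.1 ξ

theorem overlap_subset {A E E' : Set (Rd d)} (hE : E ⊆ A) (hE' : E' ⊆ A) (α : Rd d) :
    overlap E E' α ⊆ overlap A A α := fun _ h => ⟨hE h.1, hE' h.2⟩

theorem summable_norm_coefficient {C : P → Matrix (Fin d) (Fin d) ℝ} {g h : P → L2Rd d}
    {A E E' : Set (Rd d)} (hA : MeasurableSet A) (hg : LocalBound C g A) (hh : LocalBound C h A)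
    (hE : E ⊆ A) (hE' : E' ⊆ A) : Summable fun i => ‖coefficient C g h E E' i‖ := by
  refine tsum_enorm_ne_top_iff_summable_norm.1
    (ne_top_of_le_ne_top (tsum_lintegral_symbolTerm_ne_top hA hg hh)
      (ENNReal.tsum_le_tsum fun i => ?_))
  exact (enorm_integral_le_lintegral_enorm _).trans
    (lintegral_mono_set (overlap_subset hE hE' _))

theorem contragredient_mulVec_eq_iff {C : Matrix (Fin d) (Fin d) ℝ} (hC : IsUnit C.det)
    (α : Rd d) (z : Fin d → ℤ) :
    latticePoint (contragredient C) z = α ↔ (Cᵀ *ᵥ fun i => α i) = fun i => (z i : ℝ) := by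
  have hC' : IsUnit (Cᵀ).det := by rwa [Matrix.det_transpose]
  constructor
  · rintro rfl
    exact transpose_mulVec_dualParam hC _
  · intro h
    rw [latticePoint, ← h, contragredient, Matrix.mulVec_mulVec, Matrix.nonsing_inv_mul _ hC',
      Matrix.one_mulVec]

/-- The pairs `(p, k)` with `C_p' k = α` correspond to the elements of `P_α`. -/
noncomputable def fiberEquiv {C : P → Matrix (Fin d) (Fin d) ℝ} (hC : ∀ p, IsUnit (C p).det)
    (α : Rd d) : {i // dualPoint C i = α} ≃ indexSet C α :=
  Equiv.ofBijective
    (fun i => ⟨i.1.1, i.1.2, (contragredient_mulVec_eq_iff (hC _) α i.1.2).1 i.2⟩) (by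
      constructor
      · rintro ⟨⟨p, k⟩, hk⟩ ⟨⟨q, l⟩, hl⟩ heq
        obtain rfl : p = q := congrArg Subtype.val heq
        have h1 := (contragredient_mulVec_eq_iff (hC p) α k).1 hk
        have h2 := (contragredient_mulVec_eq_iff (hC p) α l).1 hl
        obtain rfl : k = l := by
          funext j
          exact_mod_cast congrFun (h1.symm.trans h2) j
        rfl
      · rintro ⟨p, z, hz⟩
        exact ⟨⟨(p, z), (contragredient_mulVec_eq_iff (hC p) α z).2 hz⟩, rfl⟩)

theorem tsum_lintegral_indexSet_ne_top {C : P → Matrix (Fin d) (Fin d) ℝ} {g h : P → L2Rd d}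
    (hC : ∀ p, IsUnit (C p).det) {A : Set (Rd d)} (hA : MeasurableSet A)
    (hg : LocalBound C g A) (hh : LocalBound C h A) (α : Rd d) :
    ∑' p : indexSet C α, ∫⁻ ξ in overlap A A α, ‖symbolTerm C g h α p ξ‖ₑ ≠ ∞ := by
  refine ne_top_of_le_ne_top (tsum_lintegral_symbolTerm_ne_top hA hg hh) ?_
  rw [← (fiberEquiv hC α).tsum_eq]
  refine le_trans (le_of_eq (tsum_congr fun i => ?_))
    (ENNReal.tsum_comp_le_tsum_of_injective Subtype.val_injective _)
  rw [i.2]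
  rfl

/-- On each shell overlap the `L¹` norms of the terms have a finite sum, and countably many overlaps
cover almost every point. -/
theorem ae_summable_symbolTerm [Countable P] {C : P → Matrix (Fin d) (Fin d) ℝ}
    {g h : P → L2Rd d} (hC : ∀ p, IsUnit (C p).det) (hg : ∀ n, LocalBound C g (shell d n))
    (hh : ∀ n, LocalBound C h (shell d n)) (α : Rd d) :
    ∀ᵐ ξ : Rd d, Summable fun p : indexSet C α => symbolTerm C g h α p ξ := by
  have key : ∀ n, ∀ᵐ ξ : Rd d, ξ ∈ overlap (shell d n) (shell d n) α →
      Summable fun p : indexSet C α => ‖symbolTerm C g h α p ξ‖ := by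
    intro n
    have hm := (isOpen_shell d n).measurableSet
    rw [← ae_restrict_iff' (measurableSet_overlap hm hm α)]
    refine summable_norm_of_tsum_eLpNorm_ne_top le_rfl
      (fun p => (aestronglyMeasurable_symbolTerm C g h α p).restrict) ?_
    simp only [eLpNorm_one_eq_lintegral_enorm]
    exact tsum_lintegral_indexSet_ne_top hC hm (hg n) (hh n) α
  filter_upwards [ae_all_iff.2 key, ae_exists_mem_overlap_shell α] with ξ h1 ⟨n, hn⟩
  exact (h1 n hn).of_norm

/-- The sum of the coefficients at `α` is an integral of the symbol at `α`. -/
theorem tsum_fiber_coefficient [Countable P] {C : P → Matrix (Fin d) (Fin d) ℝ}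
    {g h : P → L2Rd d} (hC : ∀ p, IsUnit (C p).det) {A E E' : Set (Rd d)}
    (hA : MeasurableSet A) (hg : LocalBound C g A) (hh : LocalBound C h A)
    (hE : E ⊆ A) (hE' : E' ⊆ A) (α : Rd d) :
    ∑' i : {i // dualPoint C i = α}, coefficient C g h E E' i =
      ∫ ξ in overlap E E' α, ∑' p : indexSet C α, symbolTerm C g h α p ξ := by
  rw [integral_tsum (fun p : indexSet C α => (aestronglyMeasurable_symbolTerm C g h α p).restrict)
    (ne_top_of_le_ne_top (tsum_lintegral_indexSet_ne_top hC hA hg hh α)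
      (ENNReal.tsum_le_tsum fun p => lintegral_mono_set (overlap_subset hE hE' α))),
    ← (fiberEquiv hC α).tsum_eq]
  refine tsum_congr fun i => ?_
  rw [coefficient, i.2]
  rfl

theorem integrableOn_tsum_symbolTerm [Countable P] {C : P → Matrix (Fin d) (Fin d) ℝ}
    {g h : P → L2Rd d} (hC : ∀ p, IsUnit (C p).det) {A : Set (Rd d)}
    (hA : MeasurableSet A) (hg : LocalBound C g A) (hh : LocalBound C h A) (α : Rd d) :
    IntegrableOn (fun ξ => ∑' p : indexSet C α, symbolTerm C g h α p ξ) (overlap A A α) := by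
  have hm := fun p : indexSet C α => (aestronglyMeasurable_symbolTerm C g h α p).restrict
    (s := overlap A A α)
  refine ⟨(AEMeasurable.tsum fun p => (hm p).aemeasurable).aestronglyMeasurable, ?_⟩
  refine lt_of_le_of_lt (lintegral_mono fun ξ => enorm_tsum_le_tsum_enorm) ?_
  rw [lintegral_tsum fun p => (hm p).enorm]
  exact (tsum_lintegral_indexSet_ne_top hC hA hg hh α).lt_top

end Symbol

/-! ### The almost periodic correlation function of `Θ` -/

section Correlation

variable {d : ℕ} {P : Type*}

theorem hasSum_inner_Theta {C : P → Matrix (Fin d) (Fin d) ℝ} {g h : P → L2Rd d}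
    (hg : IsBessel (translationSystem C g)) (hh : IsBessel (translationSystem C h))
    (u v : L2Rd d) :
    HasSum (fun q => inner ℂ (translationSystem C h q) v * inner ℂ u (translationSystem C g q))
      (inner ℂ u (Theta hg hh v)) := by
  have := (hasSum_mixedGramian hh hg v).mapL (innerSL ℂ u)
  refine this.congr_fun fun q => ?_
  simp

/-- The Bessel conditions allow the sum for `Θ` to be taken layer by layer, and local integrability
allows the resulting iterated series of characters to be read as one absolutely convergent series.
-/
theorem inner_Theta_translation_bandlimited {C : P → Matrix (Fin d) (Fin d) ℝ}
    (hC : ∀ p, IsUnit (C p).det) {g h : P → L2Rd d}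
    (hg : IsBessel (translationSystem C g)) (hh : IsBessel (translationSystem C h))
    {A E E' : Set (Rd d)} {R : ℝ} (hA : MeasurableSet A) (hgA : LocalBound C g A)
    (hhA : LocalBound C h A) (hAR : ∀ ξ ∈ A, ‖ξ‖ ≤ R) (hEA : E ⊆ A) (hEA' : E' ⊆ A)
    (hE : MeasurableSet E) (hE' : MeasurableSet E') (hEv : volume E ≠ ∞) (hEv' : volume E' ≠ ∞)
    (x : Rd d) :
    inner ℂ (translation x (bandlimited hE' hEv'))
        (Theta hg hh (translation x (bandlimited hE hEv))) =
      ∑' i, coefficient C g h E E' i * character x (dualPoint C i) := by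
  have hsum : Summable fun i => coefficient C g h E E' i * character x (dualPoint C i) := by
    refine Summable.of_norm ?_
    simpa using summable_norm_coefficient hA hgA hhA hEA hEA'
  have h1 := (hasSum_inner_Theta hg hh (translation x (bandlimited hE' hEv'))
    (translation x (bandlimited hE hEv))).prod_fiberwise fun p =>
      hasSum_layer C g h p (hC p) hE hE' hEv hEv' (fun ξ hξ => hAR ξ (hEA hξ))
        (fun ξ hξ => hAR ξ (hEA' hξ)) x
  rw [← h1.tsum_eq, hsum.tsum_prod]
  rfl

/-- Demodulation by `β` moves the frequency `β` to `0`, where the uniqueness result for the trivial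
character applies. -/
theorem tsum_fiber_eq_of_const {ι : Type*} [Countable ι] {c : ι → ℂ}
    (hc : Summable fun i => ‖c i‖) (α : ι → Rd d) (β : Rd d) {K : ℂ}
    (hK : ∀ x, ∑' i, c i * character x (α i - β) = K) :
    ∑' i : {i // α i = β}, c i = K := by
  have h := tsum_trivial_character_eq hc (fun i => α i - β) hK
  simp only [sub_eq_zero] at h
  rw [← h, ← tsum_subtype]
  rfl

theorem eq_zero_of_forall_inner_bandlimited {v : L2Rd d}
    (hv : ∀ (n : ℕ) (E : Set (Rd d)) (hE : MeasurableSet E) (hEv : volume E ≠ ∞),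
      E ⊆ shell d n → inner ℂ (bandlimited hE hEv) v = 0) : v = 0 := by
  refine eq_zero_of_fhat_ae_eq_zero ?_
  have key : ∀ n, ∀ᵐ ξ : Rd d, ξ ∈ shell d n → fhat v ξ = 0 := by
    intro n
    have hm := (isOpen_shell d n).measurableSet
    rw [← ae_restrict_iff' hm]
    have hint : Integrable (fhat v) (volume.restrict (shell d n)) :=
      (integrable_indicator_iff hm).1
        (integrable_indicator_of_memLp hm (volume_shell_ne_top d n) (memLp_fhat v))
    refine hint.ae_eq_zero_of_forall_setIntegral_eq_zero fun s hs _ => ?_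
    rw [Measure.restrict_restrict hs]
    have hEs := hs.inter hm
    have hEv : volume (s ∩ shell d n) ≠ ∞ :=
      measure_ne_top_of_subset Set.inter_subset_right (volume_shell_ne_top d n)
    rw [← hv n _ hEs hEv Set.inter_subset_right, inner_eq_integral_fhat,
      ← integral_indicator hEs]
    refine integral_congr_ae ?_
    filter_upwards [fhat_bandlimited hEs hEv] with ξ hξ
    rw [hξ]
    by_cases h : ξ ∈ s ∩ shell d n
    · simp only [Set.indicator_of_mem h, Pi.one_apply, map_one, one_mul]
    · simp only [Set.indicator_of_notMem h, map_zero, zero_mul]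
  filter_upwards [ae_all_iff.2 key, ae_exists_mem_shell d] with ξ h1 ⟨n, hn⟩
  exact h1 n hn

theorem continuousLinearMap_eq_zero_of_bandlimited {T : L2Rd d →L[ℂ] L2Rd d}
    (hT : ∀ (n : ℕ) (E E' : Set (Rd d)) (hE : MeasurableSet E) (hE' : MeasurableSet E')
      (hEv : volume E ≠ ∞) (hEv' : volume E' ≠ ∞), E ⊆ shell d n → E' ⊆ shell d n →
      inner ℂ (bandlimited hE' hEv') (T (bandlimited hE hEv)) = 0) : T = 0 := by
  have h1 : ∀ (n : ℕ) (E : Set (Rd d)) (hE : MeasurableSet E) (hEv : volume E ≠ ∞),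
      E ⊆ shell d n → T (bandlimited hE hEv) = 0 := by
    intro n E hE hEv hEn
    refine eq_zero_of_forall_inner_bandlimited fun m E' hE' hEv' hEm => ?_
    exact hT (max m n) E E' hE hE' hEv hEv' (hEn.trans (shell_mono d (le_max_right _ _)))
      (hEm.trans (shell_mono d (le_max_left _ _)))
  -- Passing to the adjoint lets the same separation lemma be used in the other variable.
  have h2 : ∀ v, ContinuousLinearMap.adjoint T v = 0 := by
    intro v
    refine eq_zero_of_forall_inner_bandlimited fun n E hE hEv hEn => ?_
    rw [ContinuousLinearMap.adjoint_inner_right, h1 n E hE hEv hEn, inner_zero_left]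
  ext1 v
  refine ext_inner_left ℂ fun w => ?_
  rw [← ContinuousLinearMap.adjoint_inner_left, h2 w]
  simp

theorem indexSet_zero (C : P → Matrix (Fin d) (Fin d) ℝ) : indexSet C 0 = Set.univ := by
  refine Set.eq_univ_of_forall fun p => ⟨0, ?_⟩
  funext i
  simp [Matrix.mulVec, dotProduct]

theorem tsum_indexSet_zero (C : P → Matrix (Fin d) (Fin d) ℝ) (g h : P → L2Rd d) (ξ : Rd d) :
    ∑' p : indexSet C 0, symbolTerm C g h 0 p ξ = symbol C g h ξ := by
  rw [tsum_subtype (indexSet C 0) fun p => symbolTerm C g h 0 p ξ, indexSet_zero,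
    Set.indicator_univ]
  simp [symbol, symbolTerm]

theorem ae_tsum_symbolTerm_eq_zero [Countable P] {C : P → Matrix (Fin d) (Fin d) ℝ}
    {g h : P → L2Rd d} (hC : ∀ p, IsUnit (C p).det) (hg : ∀ n, LocalBound C g (shell d n))
    (hh : ∀ n, LocalBound C h (shell d n)) {α : Rd d}
    (h0 : ∀ (n : ℕ) (E E' : Set (Rd d)), MeasurableSet E → MeasurableSet E' →
      E ⊆ shell d n → E' ⊆ shell d n →
      ∑' i : {i // dualPoint C i = α}, coefficient C g h E E' i = 0) :
    ∀ᵐ ξ : Rd d, ∑' p : indexSet C α, symbolTerm C g h α p ξ = 0 := by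
  have key : ∀ n, ∀ᵐ ξ : Rd d, ξ ∈ overlap (shell d n) (shell d n) α →
      ∑' p : indexSet C α, symbolTerm C g h α p ξ = 0 := by
    intro n
    have hm := (isOpen_shell d n).measurableSet
    have hO := measurableSet_overlap hm hm α
    rw [← ae_restrict_iff' hO]
    refine Integrable.ae_eq_zero_of_forall_setIntegral_eq_zero
      (integrableOn_tsum_symbolTerm hC hm (hg n) (hh n) α) fun s hs _ => ?_
    rw [Measure.restrict_restrict hs]
    -- With this `E` and the whole shell as `E'`, the overlap is `E` itself, so arbitrary measurable
    -- subsets of the shell overlap are tested.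
    set E := s ∩ overlap (shell d n) (shell d n) α
    have hE : E ⊆ shell d n := fun ξ hξ => hξ.2.1
    have hEE : overlap E (shell d n) α = E :=
      Set.ext fun ξ => ⟨fun hξ => hξ.1, fun hξ => ⟨hξ, hξ.2.2⟩⟩
    have h1 := tsum_fiber_coefficient hC hm (hg n) (hh n) hE subset_rfl α
    rw [h0 n E _ (hs.inter hO) hm hE subset_rfl, hEE] at h1
    exact h1.symm
  filter_upwards [ae_all_iff.2 key, ae_exists_mem_overlap_shell α] with ξ h1 ⟨n, hn⟩
  exact h1 n hn

end Correlation

/-! ### The two characterizations of `Θ = 0`. -/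

theorem corollaryC {d : ℕ} {P : Type*} [Countable P]
    (C : P → Matrix (Fin d) (Fin d) ℝ) (hC : ∀ p, IsUnit (C p).det)
    (g h : P → L2Rd d)
    (hg : IsBessel (translationSystem C g)) (hh : IsBessel (translationSystem C h))
    (hgL : LocallyIntegrableSystem C g) (hhL : LocallyIntegrableSystem C h) :
    -- the series below converge (absolutely) almost everywhere
    (∀ᵐ ξ : Rd d, Summable fun p : P => symbolTerm C g h 0 p ξ) ∧
    (∀ α ∈ dualLattices C, ∀ᵐ ξ : Rd d,
      Summable fun p : indexSet C α => symbolTerm C g h α p ξ) ∧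
    -- the first characterization
    (Theta hg hh = 0 ↔
      Theta hg hh ∈ translationCommutant d ∧ ∀ᵐ ξ : Rd d, symbol C g h ξ = 0) ∧
    -- the second characterization
    (Theta hg hh = 0 ↔
      (∀ α ∈ dualLattices C \ {0}, ∀ᵐ ξ : Rd d,
        ∑' p : indexSet C α, symbolTerm C g h α p ξ = 0) ∧
      ∀ᵐ ξ : Rd d, symbol C g h ξ = 0) := by
  have hgB := localBound_shell hg hgL
  have hhB := localBound_shell hh hhL
  have hm : ∀ n, MeasurableSet (shell d n) := fun n => (isOpen_shell d n).measurableSet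
  have hfin : ∀ {n : ℕ} {E : Set (Rd d)}, E ⊆ shell d n → volume E ≠ ∞ :=
    fun hE => measure_ne_top_of_subset hE (volume_shell_ne_top d _)
  have hcoef : ∀ {n : ℕ} {E E' : Set (Rd d)}, E ⊆ shell d n → E' ⊆ shell d n →
      Summable fun i => ‖coefficient C g h E E' i‖ :=
    fun hE hE' => summable_norm_coefficient (hm _) (hgB _) (hhB _) hE hE'
  have hsummable := ae_summable_symbolTerm hC hgB hhB
  have hvanish : Theta hg hh = 0 → ∀ α, ∀ᵐ ξ : Rd d,
      ∑' p : indexSet C α, symbolTerm C g h α p ξ = 0 := by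
    intro hΘ α
    refine ae_tsum_symbolTerm_eq_zero hC hgB hhB fun n E E' hE hE' hEn hEn' => ?_
    refine tsum_fiber_eq_of_const (hcoef hEn hEn') _ _ fun x => ?_
    have h1 := inner_Theta_translation_bandlimited hC hg hh (hm n) (hgB n) (hhB n)
      (fun ξ hξ => norm_le_of_mem_shell hξ) hEn hEn' hE hE' (hfin hEn) (hfin hEn') x
    -- The factor at `-α` does not depend on the summation index; what remains is the correlation of
    -- `Θ = 0`.
    simp only [sub_eq_add_neg, character_add_right, ← mul_assoc]
    rw [tsum_mul_right, ← h1, hΘ]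
    simp
  have hsymbol : Theta hg hh = 0 → ∀ᵐ ξ : Rd d, symbol C g h ξ = 0 := by
    intro hΘ
    simpa only [tsum_indexSet_zero] using hvanish hΘ 0
  have hfiber : ∀ {n : ℕ} {E E' : Set (Rd d)}, E ⊆ shell d n → E' ⊆ shell d n → ∀ {α : Rd d},
      (∀ᵐ ξ : Rd d, ∑' p : indexSet C α, symbolTerm C g h α p ξ = 0) →
      ∑' i : {i // dualPoint C i = α}, coefficient C g h E E' i = 0 := by
    intro n E E' hE hE' α hα
    rw [tsum_fiber_coefficient hC (hm n) (hgB n) (hhB n) hE hE']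
    exact integral_eq_zero_of_ae (ae_restrict_of_ae hα)
  refine ⟨?_, fun α _ => hsummable α, ⟨fun hΘ => ⟨?_, hsymbol hΘ⟩, fun ⟨hcomm, hs⟩ => ?_⟩,
    ⟨fun hΘ => ⟨fun α _ => hvanish hΘ α, hsymbol hΘ⟩, fun ⟨hα, hs⟩ => ?_⟩⟩
  · filter_upwards [hsummable 0] with ξ hξ
    have h1 := summable_subtype_iff_indicator (s := indexSet C 0)
      (f := fun p => symbolTerm C g h 0 p ξ) |>.1 hξ
    rwa [indexSet_zero, Set.indicator_univ] at h1
  · rw [hΘ]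
    exact Set.mem_centralizer_iff.2 fun m _ => (mul_zero m).trans (zero_mul m).symm
  · refine continuousLinearMap_eq_zero_of_bandlimited
      fun n E E' hE hE' hEv hEv' hEn hEn' => ?_
    have hs' : ∀ᵐ ξ : Rd d, ∑' p : indexSet C 0, symbolTerm C g h 0 p ξ = 0 := by
      simpa only [tsum_indexSet_zero] using hs
    rw [← hfiber hEn hEn' hs']
    -- The correlation is constant in `x`, because `Θ` commutes with the isometry `T_x`; it
    -- therefore equals its coefficient at frequency `0`.
    refine (tsum_fiber_eq_of_const (hcoef hEn hEn') _ _ fun x => ?_).symm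
    simp only [sub_zero]
    rw [← inner_Theta_translation_bandlimited hC hg hh (hm n) (hgB n) (hhB n)
      (fun ξ hξ => norm_le_of_mem_shell hξ) hEn hEn' hE hE' hEv hEv' x]
    have h1 : translation x * Theta hg hh = Theta hg hh * translation x :=
      Set.mem_centralizer_iff.1 hcomm _ ⟨x, rfl⟩
    have h2 : Theta hg hh (translation x (bandlimited hE hEv)) =
        translation x (Theta hg hh (bandlimited hE hEv)) :=
      (DFunLike.congr_fun h1 (bandlimited hE hEv)).symm
    rw [h2]
    exact LinearIsometry.inner_map_map _ _ _
  · refine continuousLinearMap_eq_zero_of_bandlimited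
      fun n E E' hE hE' hEv hEv' hEn hEn' => ?_
    have h1 := inner_Theta_translation_bandlimited hC hg hh (hm n) (hgB n) (hhB n)
      (fun ξ hξ => norm_le_of_mem_shell hξ) hEn hEn' hE hE' hEv hEv' 0
    have h0 : ∀ f : L2Rd d, translation 0 f = f := by
      intro f
      apply Lp.ext
      filter_upwards [coeFn_translation 0 f] with ξ hξ
      simpa using hξ
    simp only [h0, character_zero_left, mul_one] at h1
    -- At `x = 0` all characters equal `1`, and absolute convergence permits grouping by the value
    -- of `C_p' k`. The outer sum runs over all of `ℝᵈ`; fibers off `Λ` are empty.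
    rw [h1, ← ((hcoef hEn hEn').of_norm.hasSum.tsum_fiberwise (dualPoint C)).tsum_eq]
    rw [← tsum_zero (β := Rd d)]
    refine tsum_congr fun α => ?_
    change ∑' i : {i // dualPoint C i = α}, coefficient C g h E E' i = 0
    by_cases hΛ : α ∈ dualLattices C
    · by_cases hα0 : α = 0
      · subst hα0
        exact hfiber hEn hEn' (by simpa only [tsum_indexSet_zero] using hs)
      · exact hfiber hEn hEn' (hα α ⟨hΛ, hα0⟩)
    · have : IsEmpty {i // dualPoint C i = α} :=
        ⟨fun i => hΛ (Set.mem_iUnion.2 ⟨i.1.1, i.1.2, i.2⟩)⟩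
      exact tsum_empty
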